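/- Let $\omega,k_B,\mathsf T,T>0$, $x_0,v_0\in\mathbb R$, $\gamma=2k_B\mathsf T$. For $\beta>0$ consider on $[0,T]$ the Langevin equation $$dX_t=V_t\,dt,\qquad dV_t=-\omega^2X_t\,dt-\beta V_t\,dt+\sqrt{2\beta k_B\mathsf T}\,dW_t,\qquad X_0=x_0,\ V_0=v_0,$$ with $W$ a standard Brownian motion. Its drift matrix $\begin{pmatrix}0&-1\\ \omega^2&\beta\end{pmatrix}$ has the (possibly complex) eigenvalues $\mu_{1},\mu_2=\beta/2\pm\sqrt{\beta^2/4-\omega^2}$ (with multiplicity). Let $$\phi(\mu_1,\mu_2,\tilde\mu_1,\tilde\mu_2)=\frac{\gamma\sqrt{(\mu_1+\mu_2)(\tilde\mu_1+\tilde\mu_2)}}{(\mu_1-\mu_2)(\tilde\mu_1-\tilde\mu_2)}\Big(\frac{1-e^{-(\mu_1+\tilde\mu_1)T}}{\mu_1+\tilde\mu_1}-\frac{1-e^{-(\mu_1+\tilde\mu_2)T}}{\mu_1+\tilde\mu_2}-\frac{1-e^{-(\mu_2+\tilde\mu_1)T}}{\mu_2+\tilde\mu_1}+\frac{1-e^{-(\mu_2+\tilde\mu_2)T}}{\mu_2+\tilde\mu_2}\Big)$$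 and $\psi(\mu_1,\mu_2)=\phi(\mu_1,\mu_2,\mu_1,\mu_2)$. (1) Let $\beta,\tilde\beta>0$ with $\beta,\tilde\beta\neq2\omega$ (no critical damping), with eigenvalues $\mu_j,\tilde\mu_j$, and let $(X,V)$, $(\tilde X,\tilde V)$ solve the equation with frictions $\beta$, $\tilde\beta$ and the same initial point $(x_0,v_0)$. Then $X_T,V_T,\tilde X_T,\tilde V_T$ are square integrable. If both solutions are driven by the same Brownian motion, then $\operatorname{Cov}[X_T,\tilde X_T]=\phi(\mu_1,\mu_2,\tilde\mu_1,\tilde\mu_2)$; if they are driven by independent Brownian motions, then $\operatorname{Cov}[X_T,\tilde X_T]=0$. In both cases $\operatorname{Var}[X_T]=\psi(\mu_1,\mu_2)$ and $\operatorname{Var}[\tilde X_T]=\psi(\tilde\mu_1,\tilde\mu_2)$. (2) Fix $\beta>0$, $\beta\ne2\omega$. Let $\mu_j(\varepsilon)$ be the eigenvalues at friction $\beta+\varepsilon$, and put $\psi(\varepsilon)=\psi(\mu_1(\varepsilon),\mu_2(\varepsilon))$, $\phi(\varepsilon)=\phi(\mu_1(\varepsilon),\mu_2(\varepsilon),\mu_1(-\varepsilon),\mu_2(-\varepsilon))$.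 Both functions are three times continuously differentiable near $\varepsilon=0$; as $\varepsilon\to0$, $\psi(\pm\varepsilon)=\psi(0)\pm\psi'(0)\varepsilon+\tfrac12\psi''(0)\varepsilon^2+O(\varepsilon^3)$ and $\phi(\varepsilon)=\phi(0)+\phi'(0)\varepsilon+\tfrac12\phi''(0)\varepsilon^2+O(\varepsilon^3)$; moreover $\psi(0)=\phi(0)>0$ and $\phi'(0)=0$. For the central difference, that is, for frictions $\beta+\varepsilon$ (for $X$) and $\beta-\varepsilon$ (for $\tilde X$): (a) under a common Brownian motion, $\operatorname{Var}[X_T-\tilde X_T]=c\,\varepsilon^2+O(\varepsilon^3)$ with $c=\psi''(0)-\phi''(0)>0$: the zeroth and first order terms vanish, the second order term does not; (b) under independent Brownian motions, $\operatorname{Var}[X_T-\tilde X_T]=2\psi(0)+O(\varepsilon^2)$, which is of exact order $O(1)$. (3) Fix $\beta>0$, $\beta\ne 2\omega$. For each of the central, forward and backward differences, i.e. for the frictions $(\beta+\varepsilon,\beta-\varepsilon)$, $(\beta+\varepsilon,\beta)$, $(\beta,\beta-\varepsilon)$, as $\varepsilon\to0$: under a common Brownian motion $\operatorname{Var}[X_T-\tilde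 X_T]$, $\operatorname{Var}[V_T-\tilde V_T]$ and $\operatorname{Cov}[X_T-\tilde X_T,V_T-\tilde V_T]$ are $O(\varepsilon^2)$; under independent Brownian motions they are $O(1)$, and the two variances are bounded below by a positive constant. In (2) and (3) the constants, and the range of small $\varepsilon$ for which the bounds hold, do not depend on the probability space or on the solutions. -/

import Mathlib

open MeasureTheory ProbabilityTheory Set Filter Topology Asymptotics
open scoped NNReal ENNReal

universe u

noncomputable section

namespace Langevin

/-- The drift matrix `B` of the Langevin equation with harmonic potential, written as the
two-dimensional system `dY = -B Y dt + Σ dW` for `Y = (X, V)`. -/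
def driftMatrix (ω β : ℝ) : Matrix (Fin 2) (Fin 2) ℝ :=
  !![0, -1; ω ^ 2, β]

/-- The eigenvalue `μ₁ = β/2 + √(β²/4 - ω²)` of the drift matrix. The square root is the complex
one, so that the underdamped case `β < 2ω` is covered. -/
def mu₁ (ω β : ℝ) : ℂ :=
  (β / 2 : ℂ) + Complex.sqrt ((β : ℂ) ^ 2 / 4 - (ω : ℂ) ^ 2)

/-- The eigenvalue `μ₂ = β/2 - √(β²/4 - ω²)` of the drift matrix. -/
def mu₂ (ω β : ℝ) : ℂ :=
  (β / 2 : ℂ) - Complex.sqrt ((β : ℂ) ^ 2 / 4 - (ω : ℂ) ^ 2)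

/-- The function `φ(μ₁, μ₂, μ̃₁, μ̃₂)`, here `phi γ T m₁ m₂ n₁ n₂`. -/
def phi (γ T : ℝ) (m₁ m₂ n₁ n₂ : ℂ) : ℂ :=
  (γ : ℂ) * Complex.sqrt ((m₁ + m₂) * (n₁ + n₂)) / ((m₁ - m₂) * (n₁ - n₂)) *
    ((1 - Complex.exp (-(m₁ + n₁) * T)) / (m₁ + n₁)
      - (1 - Complex.exp (-(m₁ + n₂) * T)) / (m₁ + n₂)
      - (1 - Complex.exp (-(m₂ + n₁) * T)) / (m₂ + n₁)
      + (1 - Complex.exp (-(m₂ + n₂) * T)) / (m₂ + n₂))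

/-- `ψ(μ₁, μ₂) = φ(μ₁, μ₂, μ₁, μ₂)`. -/
def psi (γ T : ℝ) (m₁ m₂ : ℂ) : ℂ :=
  phi γ T m₁ m₂ m₁ m₂

/-- `ε ↦ ψ(μ₁(ε), μ₂(ε))`, with `μⱼ(ε)` the eigenvalues at friction `β + ε`. -/
def psiPert (γ T ω β ε : ℝ) : ℂ :=
  psi γ T (mu₁ ω (β + ε)) (mu₂ ω (β + ε))

/-- `ε ↦ φ(μ₁(ε), μ₂(ε), μ₁(-ε), μ₂(-ε))`, with `μⱼ(ε)` the eigenvalues at friction `β + ε`. -/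
def phiPert (γ T ω β ε : ℝ) : ℂ :=
  phi γ T (mu₁ ω (β + ε)) (mu₂ ω (β + ε)) (mu₁ ω (β - ε)) (mu₂ ω (β - ε))

variable {Ω : Type u} [MeasurableSpace Ω]

/-- `(X, V)` solves, on the time interval `[0, T]`, the Langevin equation
`dX = V dt`, `dV = -ω² X dt - β V dt + √(2 β k_B Temp) dW`, `X₀ = x₀`, `V₀ = v₀`,
driven by the process `W`: almost surely the paths are continuous and satisfy the equation in
integrated form. As the diffusion coefficient is constant, its stochastic integral over `[0, t]`
is the coefficient times `W t` (a Brownian motion starts at `0`). -/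
structure IsSolution (ω kB Temp x₀ v₀ T β : ℝ) (P : Measure Ω) (W : ℝ≥0 → Ω → ℝ)
    (X V : ℝ → Ω → ℝ) : Prop where
  aemeasurable_pos : ∀ t ∈ Icc (0 : ℝ) T, AEMeasurable (X t) P
  aemeasurable_vel : ∀ t ∈ Icc (0 : ℝ) T, AEMeasurable (V t) P
  continuous_pos : ∀ᵐ a ∂P, ContinuousOn (fun t => X t a) (Icc 0 T)
  continuous_vel : ∀ᵐ a ∂P, ContinuousOn (fun t => V t a) (Icc 0 T)
  eq_pos : ∀ᵐ a ∂P, ∀ t ∈ Icc (0 : ℝ) T,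
    X t a = x₀ + ∫ s in (0 : ℝ)..t, V s a
  eq_vel : ∀ᵐ a ∂P, ∀ t ∈ Icc (0 : ℝ) T,
    V t a = v₀ + (∫ s in (0 : ℝ)..t, (-ω ^ 2 * X s a - β * V s a))
      + Real.sqrt (2 * β * kB * Temp) * W t.toNNReal a

/-- `(X, V)` and `(X', V')` solve the Langevin equations with frictions `β` and `β'`, from the same
initial point, driven by one common Brownian motion. -/
def IsCommonPathCoupling (ω kB Temp x₀ v₀ T β β' : ℝ) (P : Measure Ω)
    (X V X' V' : ℝ → Ω → ℝ) : Prop :=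
  ∃ W : ℝ≥0 → Ω → ℝ, IsBrownianReal W P ∧
    IsSolution ω kB Temp x₀ v₀ T β P W X V ∧
    IsSolution ω kB Temp x₀ v₀ T β' P W X' V'

/-- `(X, V)` and `(X', V')` solve the Langevin equations with frictions `β` and `β'`, from the same
initial point, driven by two independent Brownian motions. -/
def IsIndependentCoupling (ω kB Temp x₀ v₀ T β β' : ℝ) (P : Measure Ω)
    (X V X' V' : ℝ → Ω → ℝ) : Prop :=
  ∃ W W' : ℝ≥0 → Ω → ℝ, IsBrownianReal W P ∧ IsBrownianReal W' P ∧
    IndepFun (fun a t => W t a) (fun a t => W' t a) P ∧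
    IsSolution ω kB Temp x₀ v₀ T β P W X V ∧
    IsSolution ω kB Temp x₀ v₀ T β' P W' X' V'

/-- The perturbations of the friction in the central, forward and backward differences: the
difference `(d₁, d₂)` compares the frictions `β + d₁ ε` and `β + d₂ ε`. -/
def standardDifferences : Set (ℝ × ℝ) :=
  {(1, -1), (1, 0), (0, -1)}

end Langevin

end

noncomputable section

namespace Langevin

variable {Ω : Type u} [MeasurableSpace Ω] {P : Measure Ω}

/-! ### Wiener integrals of continuously differentiable integrands -/

/-! The equation is linear with additive noise, so each terminal value is a constant plus a Wiener
integral of a deterministic kernel. The solution is paired with a solution of the adjoint equation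
`q'' = β q' - ω² q`, path by path (`pairing_eq_of_adjoint`); suitable terminal data of `q` isolate
`X T` or `V T`. This gives the kernels `√(2 β kB Temp) g(T - s)` and `√(2 β kB Temp) g'(T - s)`,
with `g` the impulse response of the damped oscillator (`IsSolution.hasKernel`). Integrals of `C¹`
kernels against `B` are defined by integration by parts, so the Itô isometry is Fubini together with
`E[B_s B_t] = min s t`. Gaussianity serves only to put the marginals in `L²`, and independence only
to make cross moments vanish.

All second moments thereby become deterministic integrals of products of kernels over `[0, T]`,
which is why the constants depend neither on the probability space nor on the solutions. Writing `g`
through the two eigenvalues and integrating four exponentials gives `phi`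
(`ofReal_integral_posKernel_mul`).

Away from critical damping the eigenvalues are smooth in the friction and have positive real part,
so `phi` is smooth along the perturbations. Symmetry makes `phiPert` even in `ε`, hence without
first order term. For the central difference with a common path, the variance `ψ(ε) + ψ(-ε) - 2
φ(ε)` therefore starts at order `ε²` with coefficient `ψ''(0) - φ''(0)`. Its positivity is not read
off the formula: the variance is the squared `L²` norm of a difference of kernels, and near time `0`
this difference is at least a multiple of `ε s`, because the noise coefficients, which are the
initial slopes, already differ by order `ε` (`exists_integral_posKernel_sub_sq_lower_bound`).

The bounds for all the standard differences follow from Lipschitz estimates of the kernels in the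
friction, uniform on `[0, T]`, and from the nonvanishing of the kernels at the unperturbed friction.
-/

/-- `B` is a process indexed by the real line with measurable marginals, continuous paths, and, on
the half-line `t ≥ 0`, the mean and the covariance function of a standard Brownian motion. -/
structure IsRegularBrownian (B : ℝ → Ω → ℝ) (P : Measure Ω) : Prop where
  measurable : ∀ t, Measurable (B t)
  continuous : ∀ a, Continuous (fun t => B t a)
  memLp : ∀ t, MemLp (B t) 2 P
  integral_eq_zero : ∀ t, ∫ a, B t a ∂P = 0
  integral_mul : ∀ s t, 0 ≤ s → 0 ≤ t → ∫ a, B s a * B t a ∂P = min s t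

/-- A Brownian motion is indistinguishable from a process all of whose paths are continuous and
all of whose marginals are measurable. -/
theorem exists_isRegularBrownian [IsProbabilityMeasure P] {W : ℝ≥0 → Ω → ℝ}
    (hW : IsBrownianReal W P) :
    ∃ B : ℝ → Ω → ℝ, IsRegularBrownian B P ∧ ∀ᵐ a ∂P, ∀ t, B t a = W t.toNNReal a := by
  classical
  let d := TopologicalSpace.denseSeq ℝ≥0
  have hm : ∀ t, AEMeasurable (W t) P := hW.aemeasurable
  -- Almost every path is continuous and agrees with measurable versions at the countably many times
  -- of a dense sequence. Measurability at every other time then follows by a limit.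
  have hae : ∀ᵐ a ∂P, Continuous (W · a) ∧ ∀ n, W (d n) a = (hm (d n)).mk _ a := by
    filter_upwards [hW.cont, ae_all_iff.2 fun n => (hm (d n)).ae_eq_mk] with a h1 h2
    exact ⟨h1, h2⟩
  obtain ⟨A, hAsub, hAm, hA0⟩ := exists_measurable_superset_of_null hae
  have hgood : ∀ a, a ∉ A → Continuous (W · a) ∧ ∀ n, W (d n) a = (hm (d n)).mk _ a := by
    intro a ha
    by_contra h
    exact ha (hAsub h)
  -- Whole paths are set to zero on one measurable null set, which keeps every path continuous.
  let B : ℝ → Ω → ℝ := fun t a => Aᶜ.indicator (W t.toNNReal) a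
  have hAae : ∀ᵐ a ∂P, a ∈ Aᶜ := compl_mem_ae_iff.2 hA0
  have hBW : ∀ᵐ a ∂P, ∀ t, B t a = W t.toNNReal a := by
    filter_upwards [hAae] with a ha t
    exact indicator_of_mem ha _
  have hBt : ∀ t, B t =ᵐ[P] W t.toNNReal := fun t => hBW.mono fun a ha => ha t
  have hind : ∀ r : ℝ≥0, Measurable (Aᶜ.indicator (W r)) := by
    intro r
    obtain ⟨u, hu, hlim⟩ := mem_closure_iff_seq_limit.1
      (TopologicalSpace.denseRange_denseSeq ℝ≥0 r)
    refine measurable_of_tendsto_metrizable (f := fun n => Aᶜ.indicator (W (u n)))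
      (fun n => ?_) ?_
    · obtain ⟨k, hk⟩ := hu n
      have : Aᶜ.indicator (W (u n)) = Aᶜ.indicator ((hm (d k)).mk _) := by
        refine indicator_congr fun a ha => ?_
        rw [← hk]
        exact (hgood a ha).2 k
      rw [this]
      exact (hm (d k)).measurable_mk.indicator hAm.compl
    · rw [tendsto_pi_nhds]
      intro a
      by_cases ha : a ∈ Aᶜ
      · simp only [indicator_of_mem ha]
        exact ((hgood a ha).1.tendsto r).comp hlim
      · simp only [indicator_of_notMem ha]
        exact tendsto_const_nhds
  refine ⟨B, ⟨fun t => hind _, fun a => ?_, fun t => ?_, fun t => ?_, fun s t hs ht => ?_⟩, hBW⟩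
  · by_cases ha : a ∈ Aᶜ
    · simp only [B, indicator_of_mem ha]
      exact (hgood a ha).1.comp continuous_real_toNNReal
    · simp only [B, indicator_of_notMem ha]
      exact continuous_const
  · exact (memLp_congr_ae (hBt t)).2 (hW.isGaussianProcess.hasGaussianLaw_eval _).memLp_two
  · rw [integral_congr_ae (hBt t)]
    exact hW.integral_eval _
  · have hc := hW.covariance_eval s.toNNReal t.toNNReal
    rw [covariance_eq_sub (hW.isGaussianProcess.hasGaussianLaw_eval _).memLp_two
      (hW.isGaussianProcess.hasGaussianLaw_eval _).memLp_two, hW.integral_eval, zero_mul,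
      sub_zero] at hc
    have he : ∫ a, B s a * B t a ∂P = ∫ a, (W s.toNNReal * W t.toNNReal) a ∂P :=
      integral_congr_ae ((hBt s).mul (hBt t))
    rw [he, hc, NNReal.coe_min, Real.coe_toNNReal _ hs, Real.coe_toNNReal _ ht]

/-- The Wiener integral `∫₀ᵀ q dB` of a continuously differentiable function `q` with derivative
`q'`, defined through integration by parts. -/
def wienerIntegral (B : ℝ → Ω → ℝ) (T : ℝ) (q q' : ℝ → ℝ) (a : Ω) : ℝ :=
  q T * B T a - ∫ s in (0 : ℝ)..T, q' s * B s a

/-- Cauchy–Schwarz against the constant `1`, obtained by expanding the nonnegative integral of `(f -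
mean)²`. -/
theorem sq_intervalIntegral_le {T : ℝ} (hT : 0 < T) {f : ℝ → ℝ} (hf : Continuous f) :
    (∫ s in (0 : ℝ)..T, f s) ^ 2 ≤ T * ∫ s in (0 : ℝ)..T, f s ^ 2 := by
  set I := ∫ s in (0 : ℝ)..T, f s with hI
  have h0 : 0 ≤ ∫ s in (0 : ℝ)..T, (f s - I / T) ^ 2 :=
    intervalIntegral.integral_nonneg hT.le fun _ _ => sq_nonneg _
  have h1 : ∫ s in (0 : ℝ)..T, (f s - I / T) ^ 2
      = (∫ s in (0 : ℝ)..T, f s ^ 2) - 2 * (I / T) * I + (I / T) ^ 2 * T := by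
    have : ∀ s, (f s - I / T) ^ 2 = f s ^ 2 - 2 * (I / T) * f s + (I / T) ^ 2 := fun s => by ring
    simp_rw [this]
    rw [intervalIntegral.integral_add, intervalIntegral.integral_sub,
      intervalIntegral.integral_const_mul, intervalIntegral.integral_const, ← hI]
    · simp; ring
    all_goals exact Continuous.intervalIntegrable (by fun_prop) _ _
  rw [h1] at h0
  have h2 : (∫ s in (0 : ℝ)..T, f s ^ 2) - 2 * (I / T) * I + (I / T) ^ 2 * T
      = (∫ s in (0 : ℝ)..T, f s ^ 2) - I ^ 2 / T := by
    field_simp; ring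
  rw [h2, sub_nonneg, div_le_iff₀ hT] at h0
  linarith

namespace IsRegularBrownian

variable {B : ℝ → Ω → ℝ} {T : ℝ} {r : ℝ → ℝ}

theorem measurable_uncurry (hB : IsRegularBrownian B P) :
    Measurable (Function.uncurry B) :=
  measurable_uncurry_of_continuous_of_measurable hB.continuous hB.measurable

/-- Since `E[B_s²] = s`, the squared norm is `∫ r(s)² s ds`. This bound on the product space is what
justifies exchanging expectation and time integral below. -/
theorem memLp_mul_prod [IsProbabilityMeasure P] (hB : IsRegularBrownian B P)
    (hr : Continuous r) :
    MemLp (fun z : ℝ × Ω => r z.1 * B z.1 z.2) 2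
      ((volume.restrict (Ioc 0 T)).prod P) := by
  have hm : Measurable (fun z : ℝ × Ω => r z.1 * B z.1 z.2) :=
    (hr.measurable.comp measurable_fst).mul hB.measurable_uncurry
  rw [memLp_two_iff_integrable_sq hm.aestronglyMeasurable,
    integrable_prod_iff (hm.pow_const 2).aestronglyMeasurable]
  refine ⟨ae_of_all _ fun s => ?_, ?_⟩
  · simpa only [mul_pow] using (hB.memLp s).integrable_sq.const_mul (r s ^ 2)
  · have : ∀ s ∈ Ioc 0 T, ∫ a, ‖(r s * B s a) ^ 2‖ ∂P = r s ^ 2 * s := by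
      intro s hs
      have h := hB.integral_mul s s hs.1.le hs.1.le
      rw [min_self] at h
      refine Eq.trans ?_ (congrArg (r s ^ 2 * ·) h)
      simp only [← integral_const_mul]
      refine integral_congr_ae (ae_of_all _ fun a => ?_)
      simp only [norm_pow, Real.norm_eq_abs, sq_abs]
      ring
    have hi : IntegrableOn (fun s => r s ^ 2 * s) (Ioc 0 T) :=
      (Continuous.integrableOn_Icc (by fun_prop)).mono_set Ioc_subset_Icc_self
    exact hi.congr ((ae_restrict_mem measurableSet_Ioc).mono fun s hs => (this s hs).symm)

theorem memLp_intervalIntegral [IsProbabilityMeasure P] (hB : IsRegularBrownian B P)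
    (hT : 0 < T) (hr : Continuous r) :
    MemLp (fun a => ∫ s in (0 : ℝ)..T, r s * B s a) 2 P := by
  have hm : Measurable (fun z : ℝ × Ω => r z.1 * B z.1 z.2) :=
    (hr.measurable.comp measurable_fst).mul hB.measurable_uncurry
  have hI : StronglyMeasurable (fun a => ∫ s in (0 : ℝ)..T, r s * B s a) := by
    simp_rw [intervalIntegral.integral_of_le hT.le]
    exact StronglyMeasurable.integral_prod_left (f := fun s a => r s * B s a)
      hm.stronglyMeasurable
  rw [memLp_two_iff_integrable_sq hI.aestronglyMeasurable]
  have h2 := (hB.memLp_mul_prod (T := T) hr).integrable_sq.integral_prod_right.const_mul T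
  refine h2.mono' (hI.aestronglyMeasurable.pow 2) (ae_of_all _ fun a => ?_)
  rw [Real.norm_eq_abs, abs_of_nonneg (sq_nonneg _), ← intervalIntegral.integral_of_le hT.le]
  exact sq_intervalIntegral_le hT (hr.mul (hB.continuous a))

theorem integral_mul_intervalIntegral [IsProbabilityMeasure P] (hB : IsRegularBrownian B P)
    (hT : 0 < T) (hr : Continuous r) {Z : Ω → ℝ} (hZ : MemLp Z 2 P) :
    ∫ a, Z a * (∫ s in (0 : ℝ)..T, r s * B s a) ∂P
      = ∫ s in (0 : ℝ)..T, r s * ∫ a, Z a * B s a ∂P := by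
  have hint : Integrable (fun z : ℝ × Ω => Z z.2 * (r z.1 * B z.1 z.2))
      ((volume.restrict (Ioc 0 T)).prod P) :=
    (hZ.comp_snd _).integrable_mul (hB.memLp_mul_prod hr)
  have hswap := integral_integral_swap (f := fun s a => Z a * (r s * B s a)) hint
  simp_rw [intervalIntegral.integral_of_le hT.le, ← integral_const_mul, ← hswap]
  congr 1
  ext s
  congr 1
  ext a
  ring

theorem memLp_wienerIntegral [IsProbabilityMeasure P] (hB : IsRegularBrownian B P)
    (hT : 0 < T) {q q' : ℝ → ℝ} (hq' : Continuous q') :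
    MemLp (wienerIntegral B T q q') 2 P :=
  ((hB.memLp T).const_mul (q T)).sub (hB.memLp_intervalIntegral hT hq')

/-- Expectations against a Wiener integral, in terms of the expectations against the process. -/
theorem integral_mul_wienerIntegral [IsProbabilityMeasure P] (hB : IsRegularBrownian B P)
    (hT : 0 < T) {q q' : ℝ → ℝ} (hq' : Continuous q') {Z : Ω → ℝ} (hZ : MemLp Z 2 P) :
    ∫ a, Z a * wienerIntegral B T q q' a ∂P
      = q T * ∫ a, Z a * B T a ∂P - ∫ s in (0 : ℝ)..T, q' s * ∫ a, Z a * B s a ∂P := by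
  rw [← hB.integral_mul_intervalIntegral hT hq' hZ, ← integral_const_mul, ← integral_sub]
  · congr 1
    ext a
    simp only [wienerIntegral]
    ring
  · exact (hZ.integrable_mul (hB.memLp T)).const_mul _
  · exact hZ.integrable_mul (hB.memLp_intervalIntegral hT hq')

theorem integral_wienerIntegral [IsProbabilityMeasure P] (hB : IsRegularBrownian B P)
    (hT : 0 < T) {q q' : ℝ → ℝ} (hq' : Continuous q') :
    ∫ a, wienerIntegral B T q q' a ∂P = 0 := by
  have h := hB.integral_mul_wienerIntegral hT (q := q) hq' (memLp_const (1 : ℝ))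
  simpa [hB.integral_eq_zero] using h

/-- Formally `B s` is the Wiener integral of the indicator of `[0, s]`. The time integral is split
at `s`, where `min s t` changes from `t` to `s`; integration by parts on `[0, s]` leaves `∫ q`, and
the boundary terms cancel. -/
theorem integral_mul_wienerIntegral_self [IsProbabilityMeasure P] (hB : IsRegularBrownian B P)
    {q q' : ℝ → ℝ} (hq : ∀ s, HasDerivAt q (q' s) s) (hq' : Continuous q')
    (hT : 0 < T) {s : ℝ} (hs : s ∈ Icc 0 T) :
    ∫ a, B s a * wienerIntegral B T q q' a ∂P = ∫ t in (0 : ℝ)..s, q t := by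
  have hqc : Continuous q := continuous_iff_continuousAt.2 fun s => (hq s).continuousAt
  rw [hB.integral_mul_wienerIntegral hT hq' (hB.memLp s), hB.integral_mul s T hs.1 hT.le,
    min_eq_left hs.2, ← intervalIntegral.integral_add_adjacent_intervals (b := s)]
  · have h1 : ∫ t in (0 : ℝ)..s, q' t * ∫ a, B s a * B t a ∂P = ∫ t in (0 : ℝ)..s, t * q' t := by
      refine intervalIntegral.integral_congr fun t ht => ?_
      rw [uIcc_of_le hs.1] at ht
      simp only [hB.integral_mul s t hs.1 ht.1, min_eq_right ht.2]
      ring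
    have h2 : ∫ t in s..T, q' t * ∫ a, B s a * B t a ∂P = s * (q T - q s) := by
      have : ∫ t in s..T, q' t * ∫ a, B s a * B t a ∂P = ∫ t in s..T, s * q' t := by
        refine intervalIntegral.integral_congr fun t ht => ?_
        rw [uIcc_of_le hs.2] at ht
        simp only [hB.integral_mul s t hs.1 (hs.1.trans ht.1), min_eq_left ht.1]
        ring
      rw [this, intervalIntegral.integral_const_mul,
        intervalIntegral.integral_eq_sub_of_hasDerivAt (fun t _ => hq t)
          (hq'.intervalIntegrable _ _)]
    rw [h1, h2, intervalIntegral.integral_mul_deriv_eq_deriv_mul (u := fun t => t)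
      (u' := fun _ => 1) (fun t _ => hasDerivAt_id t) (fun t _ => hq t)
      (continuous_const.intervalIntegrable _ _) (hq'.intervalIntegrable _ _)]
    simp only [one_mul, zero_mul]
    ring
  · have : ContinuousOn (fun t => q' t * min s t) (uIcc 0 s) := by fun_prop
    refine this.intervalIntegrable.congr fun t ht => ?_
    rw [uIoc_of_le hs.1] at ht
    simp only [hB.integral_mul s t hs.1 ht.1.le]
  · have : ContinuousOn (fun t => q' t * min s t) (uIcc s T) := by fun_prop
    refine this.intervalIntegrable.congr fun t ht => ?_
    rw [uIoc_of_le hs.2] at ht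
    simp only [hB.integral_mul s t hs.1 (hs.1.trans ht.1.le)]

/-- The Itô isometry, in its bilinear form. -/
theorem integral_wienerIntegral_mul [IsProbabilityMeasure P] (hB : IsRegularBrownian B P)
    {p p' q q' : ℝ → ℝ} (hp : ∀ s, HasDerivAt p (p' s) s) (hp' : Continuous p')
    (hq : ∀ s, HasDerivAt q (q' s) s) (hq' : Continuous q') (hT : 0 < T) :
    ∫ a, wienerIntegral B T p p' a * wienerIntegral B T q q' a ∂P
      = ∫ t in (0 : ℝ)..T, p t * q t := by
  have hqc : Continuous q := continuous_iff_continuousAt.2 fun s => (hq s).continuousAt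
  have hpc : Continuous p := continuous_iff_continuousAt.2 fun s => (hp s).continuousAt
  simp_rw [mul_comm (wienerIntegral B T p p' _)]
  rw [hB.integral_mul_wienerIntegral hT hp' (hB.memLp_wienerIntegral hT hq')]
  simp_rw [mul_comm (wienerIntegral B T q q' _)]
  rw [hB.integral_mul_wienerIntegral_self hq hq' hT ⟨hT.le, le_rfl⟩]
  have h1 : ∫ s in (0 : ℝ)..T, p' s * ∫ a, B s a * wienerIntegral B T q q' a ∂P
      = ∫ s in (0 : ℝ)..T, p' s * ∫ t in (0 : ℝ)..s, q t := by
    refine intervalIntegral.integral_congr fun s hs => ?_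
    rw [uIcc_of_le hT.le] at hs
    simp only [hB.integral_mul_wienerIntegral_self hq hq' hT hs]
  -- A second integration by parts moves the derivative from `p` to the primitive of `q`; the
  -- boundary term at `T` cancels the one in the definition of the Wiener integral.
  rw [h1, intervalIntegral.integral_mul_deriv_eq_deriv_mul (u := p) (u' := p')
    (v := fun s => ∫ t in (0 : ℝ)..s, q t) (v' := q) (fun t _ => hp t)
    (fun t _ => hqc.integral_hasStrictDerivAt 0 t |>.hasDerivAt)
    (hp'.intervalIntegrable _ _) (hqc.intervalIntegrable _ _)]
  simp

/-- Wiener integrals against uncorrelated processes are uncorrelated. -/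
theorem integral_wienerIntegral_mul_eq_zero [IsProbabilityMeasure P] {B' : ℝ → Ω → ℝ}
    (hB : IsRegularBrownian B P) (hB' : IsRegularBrownian B' P)
    (h : ∀ s t, ∫ a, B s a * B' t a ∂P = 0)
    {p p' q q' : ℝ → ℝ} (hp' : Continuous p') (hq' : Continuous q') (hT : 0 < T) :
    ∫ a, wienerIntegral B T p p' a * wienerIntegral B' T q q' a ∂P = 0 := by
  have h1 : ∀ s, ∫ a, wienerIntegral B' T q q' a * B s a ∂P = 0 := by
    intro s
    simp_rw [mul_comm (wienerIntegral B' T q q' _)]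
    rw [hB'.integral_mul_wienerIntegral hT hq' (hB.memLp s)]
    simp [h]
  simp_rw [mul_comm (wienerIntegral B T p p' _)]
  rw [hB.integral_mul_wienerIntegral hT hp' (hB'.memLp_wienerIntegral hT hq')]
  simp [h1]

end IsRegularBrownian

/-! ### Terminal values of solutions as Wiener integrals -/

/-- `Y` is, up to an additive constant, the Wiener integral `∫₀ᵀ k (T - s) dB_s`. -/
def HasKernel (B : ℝ → Ω → ℝ) (P : Measure Ω) (T : ℝ) (Y : Ω → ℝ) (k : ℝ → ℝ) : Prop :=
  ∃ (c : ℝ) (k' : ℝ → ℝ), (∀ s, HasDerivAt k (k' s) s) ∧ Continuous k' ∧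
    ∀ᵐ a ∂P, Y a = c + wienerIntegral B T (fun s => k (T - s)) (fun s => -k' (T - s)) a

theorem HasKernel.sub {B : ℝ → Ω → ℝ} {T : ℝ} {Y Z : Ω → ℝ} {k l : ℝ → ℝ}
    (hB : IsRegularBrownian B P) (hY : HasKernel B P T Y k) (hZ : HasKernel B P T Z l) :
    HasKernel B P T (Y - Z) (fun s => k s - l s) := by
  obtain ⟨c, k', hk, hk', hY⟩ := hY
  obtain ⟨d, l', hl, hl', hZ⟩ := hZ
  refine ⟨c - d, fun s => k' s - l' s, fun s => (hk s).sub (hl s), hk'.sub hl', ?_⟩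
  filter_upwards [hY, hZ] with a h1 h2
  have hBa := hB.continuous a
  have h3 : ∫ s in (0 : ℝ)..T, -(k' (T - s) - l' (T - s)) * B s a
      = (∫ s in (0 : ℝ)..T, -k' (T - s) * B s a) - ∫ s in (0 : ℝ)..T, -l' (T - s) * B s a := by
    rw [← intervalIntegral.integral_sub
      (Continuous.intervalIntegrable (by fun_prop) _ _)
      (Continuous.intervalIntegrable (by fun_prop) _ _)]
    congr 1
    ext s
    ring
  simp only [Pi.sub_apply, h1, h2, wienerIntegral, h3]
  ring

theorem hasDerivAt_comp_const_sub {k : ℝ → ℝ} {k' T s : ℝ} (hk : HasDerivAt k k' (T - s)) :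
    HasDerivAt (fun s => k (T - s)) (-k') s := by
  simpa using hk.comp_const_sub T s

theorem HasKernel.memLp [IsProbabilityMeasure P] {B : ℝ → Ω → ℝ} {T : ℝ} (hT : 0 < T)
    {Y : Ω → ℝ} {k : ℝ → ℝ} (hB : IsRegularBrownian B P) (hY : HasKernel B P T Y k) :
    MemLp Y 2 P := by
  obtain ⟨c, k', hk, hk', hY⟩ := hY
  exact (memLp_congr_ae hY).2
    ((memLp_const c).add (hB.memLp_wienerIntegral hT (by fun_prop)))

theorem covariance_eq_integral_mul [IsProbabilityMeasure P] {Y Z I J : Ω → ℝ} {c d : ℝ}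
    (hY : ∀ᵐ a ∂P, Y a = c + I a) (hZ : ∀ᵐ a ∂P, Z a = d + J a) (hI : MemLp I 2 P)
    (hJ : MemLp J 2 P) (hI0 : ∫ a, I a ∂P = 0) (hJ0 : ∫ a, J a ∂P = 0) :
    cov[Y, Z; P] = ∫ a, I a * J a ∂P := by
  have hEY : ∫ a, Y a ∂P = c := by
    rw [integral_congr_ae hY, integral_add (integrable_const c) (hI.integrable (by norm_num)), hI0]
    simp
  have hEZ : ∫ a, Z a ∂P = d := by
    rw [integral_congr_ae hZ, integral_add (integrable_const d) (hJ.integrable (by norm_num)), hJ0]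
    simp
  rw [covariance, hEY, hEZ]
  refine integral_congr_ae ?_
  filter_upwards [hY, hZ] with a h1 h2
  rw [h1, h2]
  ring

/-- Centering removes the additive constants, the isometry gives `∫ k(T - s) l(T - s) ds`, and
reversing time removes the shift. -/
theorem HasKernel.covariance [IsProbabilityMeasure P] {B : ℝ → Ω → ℝ} {T : ℝ} (hT : 0 < T)
    {Y Z : Ω → ℝ} {k l : ℝ → ℝ} (hB : IsRegularBrownian B P) (hY : HasKernel B P T Y k)
    (hZ : HasKernel B P T Z l) :
    cov[Y, Z; P] = ∫ s in (0 : ℝ)..T, k s * l s := by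
  obtain ⟨c, k', hk, hk', hY⟩ := hY
  obtain ⟨d, l', hl, hl', hZ⟩ := hZ
  have hkc : Continuous (fun s => -k' (T - s)) := by fun_prop
  have hlc : Continuous (fun s => -l' (T - s)) := by fun_prop
  rw [covariance_eq_integral_mul hY hZ (hB.memLp_wienerIntegral hT hkc)
    (hB.memLp_wienerIntegral hT hlc) (hB.integral_wienerIntegral hT hkc)
    (hB.integral_wienerIntegral hT hlc),
    hB.integral_wienerIntegral_mul (fun s => hasDerivAt_comp_const_sub (hk _)) hkc
      (fun s => hasDerivAt_comp_const_sub (hl _)) hlc hT,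
    intervalIntegral.integral_comp_sub_left (fun s => k s * l s) T]
  simp

theorem HasKernel.variance [IsProbabilityMeasure P] {B : ℝ → Ω → ℝ} {T : ℝ} (hT : 0 < T)
    {Y : Ω → ℝ} {k : ℝ → ℝ} (hB : IsRegularBrownian B P) (hY : HasKernel B P T Y k) :
    Var[Y; P] = ∫ s in (0 : ℝ)..T, k s ^ 2 := by
  rw [← covariance_self (hY.memLp hT hB).aemeasurable, hY.covariance hT hB hY]
  simp_rw [sq]

theorem HasKernel.covariance_eq_zero [IsProbabilityMeasure P] {B B' : ℝ → Ω → ℝ} {T : ℝ}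
    (hT : 0 < T) {Y Z : Ω → ℝ} {k l : ℝ → ℝ} (hB : IsRegularBrownian B P)
    (hB' : IsRegularBrownian B' P) (h : ∀ s t, ∫ a, B s a * B' t a ∂P = 0)
    (hY : HasKernel B P T Y k) (hZ : HasKernel B' P T Z l) :
    cov[Y, Z; P] = 0 := by
  obtain ⟨c, k', hk, hk', hY⟩ := hY
  obtain ⟨d, l', hl, hl', hZ⟩ := hZ
  have hkc : Continuous (fun s => -k' (T - s)) := by fun_prop
  have hlc : Continuous (fun s => -l' (T - s)) := by fun_prop
  rw [covariance_eq_integral_mul hY hZ (hB.memLp_wienerIntegral hT hkc)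
    (hB'.memLp_wienerIntegral hT hlc) (hB.integral_wienerIntegral hT hkc)
    (hB'.integral_wienerIntegral hT hlc),
    hB.integral_wienerIntegral_mul_eq_zero hB' h hkc hlc hT]

/-- `g` is the response of the position, and `h` that of the velocity, to a unit impulse of the
velocity at time `0`. -/
structure IsImpulseResponse (ω β : ℝ) (g h : ℝ → ℝ) : Prop where
  hasDerivAt_pos : ∀ s, HasDerivAt g (h s) s
  hasDerivAt_vel : ∀ s, HasDerivAt h (-β * h s - ω ^ 2 * g s) s
  pos_zero : g 0 = 0
  vel_zero : h 0 = 1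

theorem IsImpulseResponse.continuous_pos {ω β : ℝ} {g h : ℝ → ℝ}
    (hg : IsImpulseResponse ω β g h) : Continuous g :=
  continuous_iff_continuousAt.2 fun s => (hg.hasDerivAt_pos s).continuousAt

theorem IsImpulseResponse.continuous_vel {ω β : ℝ} {g h : ℝ → ℝ}
    (hg : IsImpulseResponse ω β g h) : Continuous h :=
  continuous_iff_continuousAt.2 fun s => (hg.hasDerivAt_vel s).continuousAt

/-- Duality between the integrated Langevin equation and the adjoint equation
`q'' = β q' - ω² q`, along a single path. -/
theorem pairing_eq_of_adjoint {ω β σ x₀ v₀ T : ℝ} (hT : 0 < T) {x v w q q' : ℝ → ℝ}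
    (hx : ContinuousOn x (Icc 0 T)) (hv : ContinuousOn v (Icc 0 T)) (hw : Continuous w)
    (hxe : ∀ t ∈ Icc (0 : ℝ) T, x t = x₀ + ∫ s in (0 : ℝ)..t, v s)
    (hve : ∀ t ∈ Icc (0 : ℝ) T,
      v t = v₀ + (∫ s in (0 : ℝ)..t, (-ω ^ 2 * x s - β * v s)) + σ * w t)
    (hq : ∀ s, HasDerivAt q (q' s) s)
    (hq' : ∀ s, HasDerivAt q' (β * q' s - ω ^ 2 * q s) s) :
    (β * q T - q' T) * x T + q T * (v T - σ * w T)
      = (β * q 0 - q' 0) * x₀ + q 0 * v₀ - σ * ∫ s in (0 : ℝ)..T, q' s * w s := by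
  have hqc : Continuous q := continuous_iff_continuousAt.2 fun s => (hq s).continuousAt
  have hqc' : Continuous q' := continuous_iff_continuousAt.2 fun s => (hq' s).continuousAt
  have primitive : ∀ {f F : ℝ → ℝ} {c : ℝ}, ContinuousOn f (Icc 0 T) →
      (∀ t ∈ Icc (0 : ℝ) T, F t = c + ∫ s in (0 : ℝ)..t, f s) →
      ∀ t ∈ Ioo 0 T, HasDerivAt F (f t) t := by
    intro f F c hf hF t ht
    have hn : Icc 0 T ∈ 𝓝 t := Icc_mem_nhds ht.1 ht.2
    have hi : IntervalIntegrable f volume 0 t :=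
      (hf.mono (Icc_subset_Icc_right ht.2.le)).intervalIntegrable_of_Icc ht.1.le
    have hm : StronglyMeasurableAtFilter f (𝓝 t) :=
      ⟨Icc 0 T, hn, hf.aestronglyMeasurable measurableSet_Icc⟩
    refine ((intervalIntegral.integral_hasDerivAt_right hi hm
      (hf.continuousAt hn)).const_add c).congr_of_eventuallyEq ?_
    filter_upwards [hn] with s hs using hF s hs
  -- The path `v` need not be differentiable, since `w` is only continuous; `v - σ w` is
  -- differentiable, and the pairing is formed with it.
  have hU : ∀ t ∈ Icc (0 : ℝ) T,
      v t - σ * w t = v₀ + ∫ s in (0 : ℝ)..t, (-ω ^ 2 * x s - β * v s) := by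
    intro t ht
    rw [hve t ht]
    ring
  have hUc : ContinuousOn (fun t => v t - σ * w t) (Icc 0 T) := by fun_prop
  have hxd := primitive hv hxe
  have hUd := primitive (f := fun s => -ω ^ 2 * x s - β * v s) (by fun_prop) hU
  have h0 : (0 : ℝ) ∈ Icc 0 T := ⟨le_rfl, hT.le⟩
  have hx0 : x 0 = x₀ := by simpa using hxe 0 h0
  have hU0 : v 0 - σ * w 0 = v₀ := by simpa using hU 0 h0
  -- By the adjoint equation all terms in `x` and `v` cancel in the derivative of the pairing; only
  -- `-σ q' w` remains.
  have key := intervalIntegral.integral_eq_sub_of_hasDerivAt_of_le hT.le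
    (f := fun t => (β * q t - q' t) * x t + q t * (v t - σ * w t))
    (f' := fun t => -σ * (q' t * w t)) (by fun_prop) (fun t ht => ?_)
    (Continuous.intervalIntegrable (by fun_prop) _ _)
  · rw [intervalIntegral.integral_const_mul] at key
    rw [hx0, hU0] at key
    linarith
  · have := ((((hq t).const_mul β).sub (hq' t)).mul (hxd t ht)).add ((hq t).mul (hUd t ht))
    refine this.congr_deriv ?_
    simp only [Pi.sub_apply]
    ring

/-- With `q(s) = g(T - s)` one has `q(T) = 0` and `q'(T) = -1`, so the left side of the pairing is
`X T`. With `q(s) = g'(T - s)` one has `q(T) = 1` and `q'(T) = β`, so it is `V T - σ B T`, and `σ B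
T` is the boundary term of the Wiener integral. Existence and uniqueness of solutions play no role.
-/
theorem IsSolution.hasKernel {ω kB Temp x₀ v₀ T β : ℝ} {W : ℝ≥0 → Ω → ℝ} {X V : ℝ → Ω → ℝ}
    (hT : 0 < T) (h : IsSolution ω kB Temp x₀ v₀ T β P W X V) {B : ℝ → Ω → ℝ}
    (hB : IsRegularBrownian B P) (hBW : ∀ᵐ a ∂P, ∀ t, B t a = W t.toNNReal a)
    {g g' : ℝ → ℝ} (hg : IsImpulseResponse ω β g g') :
    HasKernel B P T (X T) (fun s => √(2 * β * kB * Temp) * g s) ∧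
      HasKernel B P T (V T) (fun s => √(2 * β * kB * Temp) * g' s) := by
  set σ := √(2 * β * kB * Temp) with hσ
  have hgc := hg.continuous_pos
  have hgc' := hg.continuous_vel
  have pairing : ∀ {q q' : ℝ → ℝ}, (∀ s, HasDerivAt q (q' s) s) →
      (∀ s, HasDerivAt q' (β * q' s - ω ^ 2 * q s) s) → ∀ᵐ a ∂P,
      (β * q T - q' T) * X T a + q T * (V T a - σ * B T a)
        = (β * q 0 - q' 0) * x₀ + q 0 * v₀ - σ * ∫ s in (0 : ℝ)..T, q' s * B s a := by
    intro q q' hq hq'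
    filter_upwards [h.continuous_pos, h.continuous_vel, h.eq_pos, h.eq_vel, hBW]
      with a h1 h2 h3 h4 h5
    refine pairing_eq_of_adjoint hT h1 h2 (hB.continuous a) h3 (fun t ht => ?_) hq hq'
    rw [h5]
    exact h4 t ht
  constructor
  · have hp := pairing (q := fun s => g (T - s)) (q' := fun s => -g' (T - s))
      (fun s => hasDerivAt_comp_const_sub (hg.hasDerivAt_pos _))
      (fun s => (hasDerivAt_comp_const_sub (hg.hasDerivAt_vel _)).neg.congr_deriv (by ring))
    refine ⟨(β * g T + g' T) * x₀ + g T * v₀, fun s => σ * g' s,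
      fun s => (hg.hasDerivAt_pos s).const_mul σ, by fun_prop, ?_⟩
    filter_upwards [hp] with a ha
    have hm : ∫ s in (0 : ℝ)..T, -(σ * g' (T - s)) * B s a
        = σ * ∫ s in (0 : ℝ)..T, -g' (T - s) * B s a := by
      rw [← intervalIntegral.integral_const_mul]
      congr 1
      ext s
      ring
    simp only [wienerIntegral, hm]
    simp only [sub_self, sub_zero, hg.pos_zero, hg.vel_zero] at ha ⊢
    linarith
  · have hp := pairing (q := fun s => g' (T - s))
      (q' := fun s => -(-β * g' (T - s) - ω ^ 2 * g (T - s)))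
      (fun s => hasDerivAt_comp_const_sub (hg.hasDerivAt_vel _))
      (fun s => (((hasDerivAt_comp_const_sub (hg.hasDerivAt_vel _)).const_mul (-β)).sub
        ((hasDerivAt_comp_const_sub (hg.hasDerivAt_pos _)).const_mul (ω ^ 2))).neg.congr_deriv
          (by ring))
    refine ⟨(β * g' T + (-β * g' T - ω ^ 2 * g T)) * x₀ + g' T * v₀,
      fun s => σ * (-β * g' s - ω ^ 2 * g s),
      fun s => (hg.hasDerivAt_vel s).const_mul σ, by fun_prop, ?_⟩
    filter_upwards [hp] with a ha
    have hm : ∫ s in (0 : ℝ)..T, -(σ * (-β * g' (T - s) - ω ^ 2 * g (T - s))) * B s a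
        = σ * ∫ s in (0 : ℝ)..T, -(-β * g' (T - s) - ω ^ 2 * g (T - s)) * B s a := by
      rw [← intervalIntegral.integral_const_mul]
      congr 1
      ext s
      ring
    simp only [wienerIntegral, hm]
    simp only [sub_self, sub_zero, hg.pos_zero, hg.vel_zero] at ha ⊢
    linarith

theorem IsCommonPathCoupling.exists_hasKernel [IsProbabilityMeasure P]
    {ω kB Temp x₀ v₀ T β β' : ℝ} {X V X' V' : ℝ → Ω → ℝ} (hT : 0 < T)
    (h : IsCommonPathCoupling ω kB Temp x₀ v₀ T β β' P X V X' V')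
    {g h' k l : ℝ → ℝ} (hg : IsImpulseResponse ω β g h') (hk : IsImpulseResponse ω β' k l) :
    ∃ B : ℝ → Ω → ℝ, IsRegularBrownian B P ∧
      HasKernel B P T (X T) (fun s => √(2 * β * kB * Temp) * g s) ∧
      HasKernel B P T (V T) (fun s => √(2 * β * kB * Temp) * h' s) ∧
      HasKernel B P T (X' T) (fun s => √(2 * β' * kB * Temp) * k s) ∧
      HasKernel B P T (V' T) (fun s => √(2 * β' * kB * Temp) * l s) := by
  obtain ⟨W, hW, h1, h2⟩ := h
  obtain ⟨B, hB, hBW⟩ := exists_isRegularBrownian hW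
  exact ⟨B, hB, (h1.hasKernel hT hB hBW hg).1, (h1.hasKernel hT hB hBW hg).2,
    (h2.hasKernel hT hB hBW hk).1, (h2.hasKernel hT hB hBW hk).2⟩

/-- Independence of the two paths is reduced to vanishing correlation at each pair of times, which
is enough for second moments of Wiener integrals. -/
theorem IsIndependentCoupling.exists_hasKernel [IsProbabilityMeasure P]
    {ω kB Temp x₀ v₀ T β β' : ℝ} {X V X' V' : ℝ → Ω → ℝ} (hT : 0 < T)
    (h : IsIndependentCoupling ω kB Temp x₀ v₀ T β β' P X V X' V')
    {g h' k l : ℝ → ℝ} (hg : IsImpulseResponse ω β g h') (hk : IsImpulseResponse ω β' k l) :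
    ∃ B B' : ℝ → Ω → ℝ, IsRegularBrownian B P ∧ IsRegularBrownian B' P ∧
      (∀ s t, ∫ a, B s a * B' t a ∂P = 0) ∧
      HasKernel B P T (X T) (fun s => √(2 * β * kB * Temp) * g s) ∧
      HasKernel B P T (V T) (fun s => √(2 * β * kB * Temp) * h' s) ∧
      HasKernel B' P T (X' T) (fun s => √(2 * β' * kB * Temp) * k s) ∧
      HasKernel B' P T (V' T) (fun s => √(2 * β' * kB * Temp) * l s) := by
  obtain ⟨W, W', hW, hW', hind, h1, h2⟩ := h
  obtain ⟨B, hB, hBW⟩ := exists_isRegularBrownian hW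
  obtain ⟨B', hB', hBW'⟩ := exists_isRegularBrownian hW'
  refine ⟨B, B', hB, hB', fun s t => ?_, (h1.hasKernel hT hB hBW hg).1,
    (h1.hasKernel hT hB hBW hg).2, (h2.hasKernel hT hB' hBW' hk).1,
    (h2.hasKernel hT hB' hBW' hk).2⟩
  have hst : IndepFun (W s.toNNReal) (W' t.toNNReal) P :=
    hind.comp (measurable_pi_apply s.toNNReal) (measurable_pi_apply t.toNNReal)
  have hBs : B s =ᵐ[P] W s.toNNReal := hBW.mono fun a ha => ha s
  have hBt : B' t =ᵐ[P] W' t.toNNReal := hBW'.mono fun a ha => ha t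
  have hc := (hst.congr hBs.symm hBt.symm).covariance_eq_zero (hB.memLp s) (hB'.memLp t)
  rwa [covariance_eq_sub (hB.memLp s) (hB'.memLp t), hB.integral_eq_zero, zero_mul,
    sub_zero] at hc

/-! ### Eigenvalues of the drift matrix -/

theorem sqrt_sq (z : ℂ) : Complex.sqrt z ^ 2 = z := by
  have := Complex.cpow_nat_inv_pow z (n := 2) (by norm_num)
  exact_mod_cast this

theorem mu₁_add_mu₂ (ω β : ℝ) : mu₁ ω β + mu₂ ω β = β := by
  simp only [mu₁, mu₂]
  ring

theorem mu₁_mul_mu₂ (ω β : ℝ) : mu₁ ω β * mu₂ ω β = (ω : ℂ) ^ 2 := by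
  simp only [mu₁, mu₂]
  linear_combination -sqrt_sq ((β : ℂ) ^ 2 / 4 - (ω : ℂ) ^ 2)

theorem charpoly_driftMatrix_roots (ω β : ℝ) :
    ((driftMatrix ω β).map (algebraMap ℝ ℂ)).charpoly.roots = {mu₁ ω β, mu₂ ω β} := by
  have h : ((driftMatrix ω β).map (algebraMap ℝ ℂ)).charpoly
      = (({mu₁ ω β, mu₂ ω β} : Multiset ℂ).map fun a => Polynomial.X - Polynomial.C a).prod := by
    rw [Matrix.charpoly_fin_two]
    have htr : ((driftMatrix ω β).map (algebraMap ℝ ℂ)).trace = mu₁ ω β + mu₂ ω β := by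
      rw [mu₁_add_mu₂]
      simp [driftMatrix, Matrix.trace_fin_two]
    have hdet : ((driftMatrix ω β).map (algebraMap ℝ ℂ)).det = mu₁ ω β * mu₂ ω β := by
      rw [mu₁_mul_mu₂]
      simp [driftMatrix, Matrix.det_fin_two]
    rw [htr, hdet]
    simp only [Multiset.insert_eq_cons, Multiset.map_cons, Multiset.map_singleton,
      Multiset.prod_cons, Multiset.prod_singleton, map_add, map_mul]
    ring
  rw [h, Polynomial.roots_multiset_prod_X_sub_C]

variable {ω β : ℝ}

theorem discriminant_ne_zero (hω : 0 < ω) (hβ : 0 < β) (hne : β ≠ 2 * ω) :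
    β ^ 2 / 4 - ω ^ 2 ≠ 0 := by
  intro h
  have : (β - 2 * ω) * (β + 2 * ω) = 0 := by linarith
  rcases mul_eq_zero.1 this with h | h
  · exact hne (by linarith)
  · linarith

theorem mu₁_sub_mu₂_ne_zero (hω : 0 < ω) (hβ : 0 < β) (hne : β ≠ 2 * ω) :
    mu₁ ω β - mu₂ ω β ≠ 0 := by
  intro h
  have h1 : Complex.sqrt ((β : ℂ) ^ 2 / 4 - (ω : ℂ) ^ 2) = 0 := by
    simp only [mu₁, mu₂] at h
    linear_combination h / 2
  have h2 := sqrt_sq ((β : ℂ) ^ 2 / 4 - (ω : ℂ) ^ 2)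
  rw [h1] at h2
  refine discriminant_ne_zero hω hβ hne ?_
  have h3 : (β : ℂ) ^ 2 / 4 - (ω : ℂ) ^ 2 = 0 := by simpa using h2.symm
  exact_mod_cast h3

/-- The imaginary part of the equation reads `z.im * (2 * z.re - β) = 0`. Either the root is real
and `β z.re = z.re² + ω² > 0`, or `z.re = β / 2`. -/
theorem re_pos_of_quadratic (hω : 0 < ω) (hβ : 0 < β) {z : ℂ}
    (hz : z ^ 2 - β * z + (ω : ℂ) ^ 2 = 0) : 0 < z.re := by
  have h1 := congrArg Complex.re hz
  have h2 := congrArg Complex.im hz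
  simp [sq] at h1 h2
  have h3 : z.im * (2 * z.re - β) = 0 := by linarith
  rcases mul_eq_zero.1 h3 with h | h
  · rw [h] at h1
    have : 0 < β * z.re := by nlinarith [mul_self_nonneg z.re]
    exact pos_of_mul_pos_right this hβ.le
  · linarith

theorem re_mu₁_pos (hω : 0 < ω) (hβ : 0 < β) : 0 < (mu₁ ω β).re :=
  re_pos_of_quadratic hω hβ
    (by linear_combination mu₁ ω β * mu₁_add_mu₂ ω β - mu₁_mul_mu₂ ω β)

theorem re_mu₂_pos (hω : 0 < ω) (hβ : 0 < β) : 0 < (mu₂ ω β).re :=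
  re_pos_of_quadratic hω hβ
    (by linear_combination mu₂ ω β * mu₁_add_mu₂ ω β - mu₁_mul_mu₂ ω β)

theorem add_ne_zero_of_re_pos {z w : ℂ} (hz : 0 < z.re) (hw : 0 < w.re) : z + w ≠ 0 := by
  intro h
  have := congrArg Complex.re h
  simp at this
  linarith

/-- The principal root jumps across the negative axis, but along the real line it is `i √(-y)` for
`y < 0` and `√y` for `y > 0`, so only `0` is singular. This treats under- and overdamping together.
-/
theorem contDiffAt_sqrt_ofReal {n : WithTop ℕ∞} {x : ℝ} (hx : x ≠ 0) :
    ContDiffAt ℝ n (fun y : ℝ => Complex.sqrt (y : ℂ)) x := by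
  rcases lt_or_gt_of_ne hx with h | h
  · have he : (fun y : ℝ => Complex.sqrt (y : ℂ)) =ᶠ[𝓝 x]
        fun y => Complex.I * ((√(-y) : ℝ) : ℂ) := by
      filter_upwards [Iio_mem_nhds h] with y hy
      have h1 := Complex.sqrt_neg_of_nonneg (a := ((-y : ℝ) : ℂ))
        (by exact_mod_cast (neg_nonneg.2 (le_of_lt hy)))
      have h2 := Complex.sqrt_of_nonneg (a := ((-y : ℝ) : ℂ))
        (by exact_mod_cast (neg_nonneg.2 (le_of_lt hy)))
      rw [h2] at h1
      simpa using h1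
    refine ContDiffAt.congr_of_eventuallyEq ?_ he
    refine contDiffAt_const.mul (Complex.ofRealCLM.contDiff.contDiffAt.comp x ?_)
    exact (contDiffAt_id.neg).sqrt (by simpa using hx)
  · have he : (fun y : ℝ => Complex.sqrt (y : ℂ)) =ᶠ[𝓝 x] fun y => ((√y : ℝ) : ℂ) := by
      filter_upwards [Ioi_mem_nhds h] with y hy
      have h2 := Complex.sqrt_of_nonneg (a := ((y : ℝ) : ℂ))
        (by exact_mod_cast (le_of_lt hy))
      simpa using h2
    refine ContDiffAt.congr_of_eventuallyEq ?_ he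
    exact Complex.ofRealCLM.contDiff.contDiffAt.comp x (contDiffAt_id.sqrt hx)

theorem contDiffAt_sqrt_discriminant {n : WithTop ℕ∞} (hω : 0 < ω) (hβ : 0 < β)
    (hne : β ≠ 2 * ω) :
    ContDiffAt ℝ n (fun b : ℝ => Complex.sqrt ((b : ℂ) ^ 2 / 4 - (ω : ℂ) ^ 2)) β := by
  have h := (contDiffAt_sqrt_ofReal (n := n) (discriminant_ne_zero hω hβ hne)).comp β
    (f := fun b : ℝ => b ^ 2 / 4 - ω ^ 2) (by fun_prop)
  convert h using 2 with b
  simp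

theorem contDiffAt_mu₁ {n : WithTop ℕ∞} (hω : 0 < ω) (hβ : 0 < β) (hne : β ≠ 2 * ω) :
    ContDiffAt ℝ n (mu₁ ω) β := by
  have h := contDiffAt_sqrt_discriminant (n := n) hω hβ hne
  have h' : ContDiffAt ℝ n (fun b : ℝ => (b / 2 : ℂ)) β :=
    (Complex.ofRealCLM.contDiff.contDiffAt).div_const 2
  exact h'.add h

theorem contDiffAt_mu₂ {n : WithTop ℕ∞} (hω : 0 < ω) (hβ : 0 < β) (hne : β ≠ 2 * ω) :
    ContDiffAt ℝ n (mu₂ ω) β := by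
  have h := contDiffAt_sqrt_discriminant (n := n) hω hβ hne
  have h' : ContDiffAt ℝ n (fun b : ℝ => (b / 2 : ℂ)) β :=
    (Complex.ofRealCLM.contDiff.contDiffAt).div_const 2
  exact h'.sub h

/-! ### Impulse responses -/

/-- The response of the position to a unit impulse of the velocity, as a complex number. -/
def posResponseC (ω b s : ℝ) : ℂ :=
  (Complex.exp (-mu₂ ω b * s) - Complex.exp (-mu₁ ω b * s)) / (mu₁ ω b - mu₂ ω b)

/-- The response of the velocity to a unit impulse of the velocity, as a complex number. -/
def velResponseC (ω b s : ℝ) : ℂ :=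
  (mu₁ ω b * Complex.exp (-mu₁ ω b * s) - mu₂ ω b * Complex.exp (-mu₂ ω b * s)) /
    (mu₁ ω b - mu₂ ω b)

/-- The response of the position to a unit impulse of the velocity. -/
def posResponse (ω b s : ℝ) : ℝ := (posResponseC ω b s).re

/-- The response of the velocity to a unit impulse of the velocity. -/
def velResponse (ω b s : ℝ) : ℝ := (velResponseC ω b s).re

theorem hasDerivAt_exp_neg_mul (m : ℂ) (s : ℝ) :
    HasDerivAt (fun s : ℝ => Complex.exp (-m * s)) (-m * Complex.exp (-m * s)) s := by
  have h : HasDerivAt (fun s : ℝ => -m * (s : ℂ)) (-m) s := by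
    simpa using (Complex.ofRealCLM.hasDerivAt (x := s)).const_mul (-m)
  simpa [mul_comm] using h.cexp

theorem hasDerivAt_posResponseC (ω b s : ℝ) :
    HasDerivAt (posResponseC ω b) (velResponseC ω b s) s := by
  refine (((hasDerivAt_exp_neg_mul (mu₂ ω b) s).sub
    (hasDerivAt_exp_neg_mul (mu₁ ω b) s)).div_const _).congr_deriv ?_
  rw [velResponseC]
  congr 1
  ring

theorem hasDerivAt_velResponseC (ω b s : ℝ) :
    HasDerivAt (velResponseC ω b) (-b * velResponseC ω b s - ω ^ 2 * posResponseC ω b s) s := by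
  refine ((((hasDerivAt_exp_neg_mul (mu₁ ω b) s).const_mul (mu₁ ω b)).sub
    ((hasDerivAt_exp_neg_mul (mu₂ ω b) s).const_mul (mu₂ ω b))).div_const _).congr_deriv ?_
  rw [velResponseC, posResponseC, ← mu₁_add_mu₂ ω b, ← mu₁_mul_mu₂]
  ring

theorem hasDerivAt_re {f : ℝ → ℂ} {f' : ℂ} {s : ℝ} (hf : HasDerivAt f f' s) :
    HasDerivAt (fun s => (f s).re) f'.re s := by
  exact Complex.reCLM.hasFDerivAt.comp_hasDerivAt s hf

theorem isImpulseResponse (hω : 0 < ω) (hβ : 0 < β) (hne : β ≠ 2 * ω) :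
    IsImpulseResponse ω β (posResponse ω β) (velResponse ω β) where
  hasDerivAt_pos s := hasDerivAt_re (hasDerivAt_posResponseC ω β s)
  hasDerivAt_vel s := by
    refine (hasDerivAt_re (hasDerivAt_velResponseC ω β s)).congr_deriv ?_
    have h1 : (-(β : ℂ) * velResponseC ω β s - (ω : ℂ) ^ 2 * posResponseC ω β s)
        = ((-β : ℝ) : ℂ) * velResponseC ω β s - ((ω ^ 2 : ℝ) : ℂ) * posResponseC ω β s := by
      push_cast
      ring
    rw [h1, Complex.sub_re, Complex.re_ofReal_mul, Complex.re_ofReal_mul]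
    rfl
  pos_zero := by simp [posResponse, posResponseC]
  vel_zero := by simp [velResponse, velResponseC, div_self (mu₁_sub_mu₂_ne_zero hω hβ hne)]

open ComplexConjugate in
-- The square of `r = √(b²/4 - ω²)` is real, so conjugation sends `r` to `r` or `-r`. The latter
-- exchanges the eigenvalues, which flips the sign of both numerator and denominator.
theorem ofReal_posResponse (ω b s : ℝ) : (posResponse ω b s : ℂ) = posResponseC ω b s := by
  rw [posResponse, ← Complex.conj_eq_iff_re]
  have hsq := sqrt_sq ((b : ℂ) ^ 2 / 4 - (ω : ℂ) ^ 2)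
  set r := Complex.sqrt ((b : ℂ) ^ 2 / 4 - (ω : ℂ) ^ 2) with hr
  have hconj : conj r ^ 2 = r ^ 2 := by
    rw [← map_pow, hsq]
    simp [map_ofNat (starRingEnd ℂ) 4]
  have h1 : mu₁ ω b = b / 2 + r := rfl
  have h2 : mu₂ ω b = b / 2 - r := rfl
  simp only [posResponseC, h1, h2, map_div₀, map_sub, ← Complex.exp_conj, map_mul, map_neg,
    map_add, Complex.conj_ofReal, map_ofNat]
  rcases sq_eq_sq_iff_eq_or_eq_neg.1 hconj with h | h
  · rw [h]
  · rw [h, ← neg_div_neg_eq]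
    congr 1
    · rw [neg_sub, ← sub_eq_add_neg, sub_neg_eq_add]
    · ring

theorem contDiffAt_exp_neg_mul {n : WithTop ℕ∞} {m : ℝ → ℂ} {b : ℝ} (hm : ContDiffAt ℝ n m b)
    (s : ℝ) : ContDiffAt ℝ n (fun p : ℝ × ℝ => Complex.exp (-m p.1 * p.2)) (b, s) := by
  have h1 : ContDiffAt ℝ n (fun p : ℝ × ℝ => m p.1) (b, s) :=
    ContDiffAt.comp (b, s) hm contDiffAt_fst
  have h2 : ContDiffAt ℝ n (fun p : ℝ × ℝ => (p.2 : ℂ)) (b, s) :=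
    Complex.ofRealCLM.contDiff.contDiffAt.comp (b, s) contDiffAt_snd
  exact (h1.neg.mul h2).cexp

/-- Smoothness is needed jointly in friction and time, so that compactness of a rectangle later
gives estimates uniform in time. -/
theorem contDiffAt_posResponse {n : WithTop ℕ∞} (hω : 0 < ω) (hβ : 0 < β) (hne : β ≠ 2 * ω)
    (s : ℝ) : ContDiffAt ℝ n (fun p : ℝ × ℝ => posResponse ω p.1 p.2) (β, s) := by
  have h1 := contDiffAt_mu₁ (n := n) hω hβ hne
  have h2 := contDiffAt_mu₂ (n := n) hω hβ hne
  have h3 : ContDiffAt ℝ n (fun p : ℝ × ℝ => mu₁ ω p.1 - mu₂ ω p.1) (β, s) :=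
    ContDiffAt.comp (β, s) (h1.sub h2) contDiffAt_fst
  refine Complex.reCLM.contDiff.contDiffAt.comp (β, s)
    (f := fun p : ℝ × ℝ => posResponseC ω p.1 p.2) ?_
  simp only [posResponseC, div_eq_mul_inv]
  exact ((contDiffAt_exp_neg_mul h2 s).sub (contDiffAt_exp_neg_mul h1 s)).mul
    (h3.inv (mu₁_sub_mu₂_ne_zero hω hβ hne))

theorem contDiffAt_velResponse {n : WithTop ℕ∞} (hω : 0 < ω) (hβ : 0 < β) (hne : β ≠ 2 * ω)
    (s : ℝ) : ContDiffAt ℝ n (fun p : ℝ × ℝ => velResponse ω p.1 p.2) (β, s) := by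
  have h1 := contDiffAt_mu₁ (n := n) hω hβ hne
  have h2 := contDiffAt_mu₂ (n := n) hω hβ hne
  have h3 : ContDiffAt ℝ n (fun p : ℝ × ℝ => mu₁ ω p.1) (β, s) :=
    ContDiffAt.comp (β, s) h1 contDiffAt_fst
  have h4 : ContDiffAt ℝ n (fun p : ℝ × ℝ => mu₂ ω p.1) (β, s) :=
    ContDiffAt.comp (β, s) h2 contDiffAt_fst
  refine Complex.reCLM.contDiff.contDiffAt.comp (β, s)
    (f := fun p : ℝ × ℝ => velResponseC ω p.1 p.2) ?_
  simp only [velResponseC, div_eq_mul_inv]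
  exact ((h3.mul (contDiffAt_exp_neg_mul h1 s)).sub (h4.mul (contDiffAt_exp_neg_mul h2 s))).mul
    ((h3.sub h4).inv (mu₁_sub_mu₂_ne_zero hω hβ hne))

/-! ### Kernels of the terminal values, and their covariances -/

/-- The kernel of the terminal position. -/
def posKernel (ω kB Temp b s : ℝ) : ℝ := √(2 * b * kB * Temp) * posResponse ω b s

/-- The kernel of the terminal velocity. -/
def velKernel (ω kB Temp b s : ℝ) : ℝ := √(2 * b * kB * Temp) * velResponse ω b s

theorem integral_exp_neg_mul {c : ℂ} (hc : c ≠ 0) (T : ℝ) :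
    ∫ s in (0 : ℝ)..T, Complex.exp (-c * s) = (1 - Complex.exp (-c * T)) / c := by
  rw [integral_exp_mul_complex (neg_ne_zero.2 hc)]
  simp only [Complex.ofReal_zero, mul_zero, Complex.exp_zero]
  rw [div_neg, ← neg_div, neg_sub]

/-- The product of two differences of exponentials expands into the four exponentials integrated in
`phi`; the noise coefficients multiply to `2 kB Temp √(β β')`, and `β` is the sum of the
eigenvalues. Critical damping is not excluded here: both sides are then `0` by the convention on
division by zero. -/
theorem ofReal_integral_posKernel_mul {kB Temp β' : ℝ} (hω : 0 < ω) (hkB : 0 < kB)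
    (hTemp : 0 < Temp) (hβ : 0 < β) (hβ' : 0 < β') (T : ℝ) :
    ((∫ s in (0 : ℝ)..T, posKernel ω kB Temp β s * posKernel ω kB Temp β' s : ℝ) : ℂ)
      = phi (2 * kB * Temp) T (mu₁ ω β) (mu₂ ω β) (mu₁ ω β') (mu₂ ω β') := by
  have hσ : √(2 * β * kB * Temp) * √(2 * β' * kB * Temp) = 2 * kB * Temp * √(β * β') := by
    rw [← Real.sqrt_mul (by positivity)]
    have : 2 * β * kB * Temp * (2 * β' * kB * Temp) = (2 * kB * Temp) ^ 2 * (β * β') := by ring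
    rw [this, Real.sqrt_mul (by positivity), Real.sqrt_sq (by positivity)]
  have hs : Complex.sqrt ((β : ℂ) * β') = ((√(β * β') : ℝ) : ℂ) := by
    have h2 := Complex.sqrt_of_nonneg (a := ((β * β' : ℝ) : ℂ))
      (by exact_mod_cast (mul_pos hβ hβ').le)
    simpa using h2
  rw [phi, mu₁_add_mu₂, mu₁_add_mu₂, hs, ← intervalIntegral.integral_ofReal]
  have h1 := re_mu₁_pos hω hβ
  have h2 := re_mu₂_pos hω hβ
  have h3 := re_mu₁_pos hω hβ'
  have h4 := re_mu₂_pos hω hβ'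
  rw [← integral_exp_neg_mul (add_ne_zero_of_re_pos h1 h3),
    ← integral_exp_neg_mul (add_ne_zero_of_re_pos h1 h4),
    ← integral_exp_neg_mul (add_ne_zero_of_re_pos h2 h3),
    ← integral_exp_neg_mul (add_ne_zero_of_re_pos h2 h4),
    ← intervalIntegral.integral_sub, ← intervalIntegral.integral_sub,
    ← intervalIntegral.integral_add, ← intervalIntegral.integral_const_mul]
  · congr 1
    ext s
    have hσ' : ((√(2 * β * kB * Temp) : ℝ) : ℂ) * ((√(2 * β' * kB * Temp) : ℝ) : ℂ)
        = ((2 * kB * Temp : ℝ) : ℂ) * ((√(β * β') : ℝ) : ℂ) := by exact_mod_cast hσ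
    simp only [posKernel, Complex.ofReal_mul,
      ofReal_posResponse, posResponseC] at hσ' ⊢
    simp only [neg_add, add_mul, Complex.exp_add]
    rw [mul_mul_mul_comm, hσ', div_mul_div_comm]
    ring
  all_goals exact Continuous.intervalIntegrable (by fun_prop) _ _

/-! ### Smoothness in the friction, and Taylor expansions -/

theorem contDiffAt_one_sub_exp_div {n : WithTop ℕ∞} {m : ℝ → ℂ} {x : ℝ} (hm : ContDiffAt ℝ n m x)
    (hne : m x ≠ 0) (T : ℝ) :
    ContDiffAt ℝ n (fun e => (1 - Complex.exp (-m e * T)) / m e) x := by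
  simp only [div_eq_mul_inv]
  exact (contDiffAt_const.sub (hm.neg.mul contDiffAt_const).cexp).mul (hm.inv hne)

/-- The radicand is the product of the frictions, which is positive; sums of eigenvalues have
positive real part, and differences vanish only at critical damping. -/
theorem contDiffAt_phi {n : WithTop ℕ∞} {γ T x : ℝ} {b b' : ℝ → ℝ} (hω : 0 < ω)
    (hb : ContDiffAt ℝ n b x) (hb' : ContDiffAt ℝ n b' x) (hpos : 0 < b x) (hne : b x ≠ 2 * ω)
    (hpos' : 0 < b' x) (hne' : b' x ≠ 2 * ω) :
    ContDiffAt ℝ n (fun e => phi γ T (mu₁ ω (b e)) (mu₂ ω (b e)) (mu₁ ω (b' e)) (mu₂ ω (b' e)))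
      x := by
  have h1 : ContDiffAt ℝ n (fun e => mu₁ ω (b e)) x := (contDiffAt_mu₁ hω hpos hne).comp x hb
  have h2 : ContDiffAt ℝ n (fun e => mu₂ ω (b e)) x := (contDiffAt_mu₂ hω hpos hne).comp x hb
  have h3 : ContDiffAt ℝ n (fun e => mu₁ ω (b' e)) x := (contDiffAt_mu₁ hω hpos' hne').comp x hb'
  have h4 : ContDiffAt ℝ n (fun e => mu₂ ω (b' e)) x := (contDiffAt_mu₂ hω hpos' hne').comp x hb'
  have hs : ContDiffAt ℝ n (fun e => Complex.sqrt ((b e : ℂ) * b' e)) x := by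
    have := (contDiffAt_sqrt_ofReal (n := n) (mul_pos hpos hpos').ne').comp x (hb.mul hb')
    convert this using 2 with e
    simp
  have r1 := re_mu₁_pos hω hpos
  have r2 := re_mu₂_pos hω hpos
  have r3 := re_mu₁_pos hω hpos'
  have r4 := re_mu₂_pos hω hpos'
  have hd : (mu₁ ω (b x) - mu₂ ω (b x)) * (mu₁ ω (b' x) - mu₂ ω (b' x)) ≠ 0 :=
    mul_ne_zero (mu₁_sub_mu₂_ne_zero hω hpos hne) (mu₁_sub_mu₂_ne_zero hω hpos' hne')
  have hpre : ContDiffAt ℝ n (fun e => (γ : ℂ) * Complex.sqrt ((b e : ℂ) * b' e) /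
      ((mu₁ ω (b e) - mu₂ ω (b e)) * (mu₁ ω (b' e) - mu₂ ω (b' e)))) x := by
    simp only [div_eq_mul_inv]
    exact (contDiffAt_const.mul hs).mul (((h1.sub h2).mul (h3.sub h4)).inv hd)
  simp only [phi, mu₁_add_mu₂]
  exact hpre.mul
    ((((contDiffAt_one_sub_exp_div (h1.add h3) (add_ne_zero_of_re_pos r1 r3) T).sub
      (contDiffAt_one_sub_exp_div (h1.add h4) (add_ne_zero_of_re_pos r1 r4) T)).sub
      (contDiffAt_one_sub_exp_div (h2.add h3) (add_ne_zero_of_re_pos r2 r3) T)).add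
      (contDiffAt_one_sub_exp_div (h2.add h4) (add_ne_zero_of_re_pos r2 r4) T))

theorem contDiffAt_psiPert {n : WithTop ℕ∞} {γ T : ℝ} (hω : 0 < ω) (hβ : 0 < β)
    (hne : β ≠ 2 * ω) : ContDiffAt ℝ n (psiPert γ T ω β) 0 :=
  contDiffAt_phi (b := fun ε => β + ε) (b' := fun ε => β + ε) hω (by fun_prop) (by fun_prop)
    (by simpa) (by simpa) (by simpa) (by simpa)

theorem contDiffAt_phiPert {n : WithTop ℕ∞} {γ T : ℝ} (hω : 0 < ω) (hβ : 0 < β)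
    (hne : β ≠ 2 * ω) : ContDiffAt ℝ n (phiPert γ T ω β) 0 :=
  contDiffAt_phi (b := fun ε => β + ε) (b' := fun ε => β - ε) hω (by fun_prop) (by fun_prop)
    (by simpa) (by simpa) (by simpa) (by simpa)

theorem phi_comm (γ T : ℝ) (m₁ m₂ n₁ n₂ : ℂ) :
    phi γ T m₁ m₂ n₁ n₂ = phi γ T n₁ n₂ m₁ m₂ := by
  simp only [phi]
  rw [mul_comm (m₁ + m₂), mul_comm (m₁ - m₂), add_comm m₁ n₁, add_comm m₁ n₂, add_comm m₂ n₁,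
    add_comm m₂ n₂]
  ring

theorem phiPert_neg (γ T ω β ε : ℝ) : phiPert γ T ω β (-ε) = phiPert γ T ω β ε := by
  rw [phiPert, phiPert, phi_comm, sub_neg_eq_add, ← sub_eq_add_neg]

/-- Replacing `ε` by `-ε` exchanges the two frictions, and `phi` is symmetric under this exchange;
so the function is even. -/
theorem deriv_phiPert (γ T ω β : ℝ) : deriv (phiPert γ T ω β) 0 = 0 := by
  have h := deriv_comp_neg (f := phiPert γ T ω β) (x := 0)
  simp only [phiPert_neg, neg_zero] at h
  exact self_eq_neg.1 h

theorem psiPert_zero (γ T ω β : ℝ) : psiPert γ T ω β 0 = phiPert γ T ω β 0 := by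
  simp [psiPert, phiPert, psi]

/-- Taylor's theorem of order three has remainder `o(ε³)`, and the cubic term that is dropped is
itself `O(ε³)`. -/
theorem taylor_two_isBigO {f : ℝ → ℂ} (hf : ContDiffAt ℝ 3 f 0) :
    (fun ε : ℝ => f ε - (f 0 + deriv f 0 * ε + iteratedDeriv 2 f 0 / 2 * ε ^ 2))
      =O[𝓝 0] (fun ε : ℝ => ε ^ 3) := by
  obtain ⟨u, hu, hfu⟩ := hf.contDiffOn le_rfl (by simp)
  obtain ⟨r, hr, hru⟩ := Metric.mem_nhds_iff.1 hu
  have hop : IsOpen (Metric.ball (0 : ℝ) r) := Metric.isOpen_ball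
  have h0 : (0 : ℝ) ∈ Metric.ball (0 : ℝ) r := Metric.mem_ball_self hr
  have ht := taylor_isLittleO (n := 3) (convex_ball (0 : ℝ) r) h0 (hfu.mono hru)
  rw [hop.nhdsWithin_eq h0] at ht
  simp only [sub_zero] at ht
  have h3 : (fun ε : ℝ => ((ε ^ 3 / 6 : ℝ) : ℂ) * iteratedDeriv 3 f 0)
      =O[𝓝 0] (fun ε : ℝ => ε ^ 3) := by
    refine IsBigO.of_bound ‖iteratedDeriv 3 f 0‖ (Eventually.of_forall fun ε => ?_)
    rw [norm_mul, Complex.norm_real, norm_div, mul_comm]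
    refine mul_le_mul_of_nonneg_left ?_ (norm_nonneg _)
    exact div_le_self (norm_nonneg _) (by norm_num)
  refine (ht.isBigO.add h3).congr_left fun ε => ?_
  have e1 : iteratedDerivWithin 1 f (Metric.ball 0 r) 0 = deriv f 0 := by
    rw [iteratedDerivWithin_of_isOpen hop h0, iteratedDeriv_one]
  have e2 := iteratedDerivWithin_of_isOpen (n := 2) (f := f) hop h0
  have e3 := iteratedDerivWithin_of_isOpen (n := 3) (f := f) hop h0
  rw [taylorWithinEval_succ, taylorWithinEval_succ, taylorWithinEval_succ,
    taylor_within_zero_eval]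
  norm_num [e1, e2, e3, Nat.factorial]
  ring

theorem taylor_two_neg_isBigO {f : ℝ → ℂ} (hf : ContDiffAt ℝ 3 f 0) :
    (fun ε : ℝ => f (-ε) - (f 0 - deriv f 0 * ε + iteratedDeriv 2 f 0 / 2 * ε ^ 2))
      =O[𝓝 0] (fun ε : ℝ => ε ^ 3) := by
  have hlim : Tendsto (fun ε : ℝ => -ε) (𝓝 0) (𝓝 0) := by
    simpa using (continuous_neg (G := ℝ)).tendsto 0
  have h := (taylor_two_isBigO hf).comp_tendsto hlim
  refine (h.congr_left fun ε => ?_).trans (IsBigO.of_bound 1 (Eventually.of_forall fun ε => ?_))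
  · simp only [Function.comp]
    push_cast
    ring
  · simp

variable {kB Temp T : ℝ}

/-! ### Bounds on the kernels that are uniform in time -/

theorem contDiffAt_posKernel (hω : 0 < ω) (hkB : 0 < kB) (hTemp : 0 < Temp) (hβ : 0 < β)
    (hne : β ≠ 2 * ω) (s : ℝ) :
    ContDiffAt ℝ 1 (fun p : ℝ × ℝ => posKernel ω kB Temp p.1 p.2) (β, s) := by
  refine ContDiffAt.mul ?_ (contDiffAt_posResponse hω hβ hne s)
  exact ContDiffAt.sqrt (by fun_prop) (by positivity)

theorem contDiffAt_velKernel (hω : 0 < ω) (hkB : 0 < kB) (hTemp : 0 < Temp) (hβ : 0 < β)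
    (hne : β ≠ 2 * ω) (s : ℝ) :
    ContDiffAt ℝ 1 (fun p : ℝ × ℝ => velKernel ω kB Temp p.1 p.2) (β, s) := by
  refine ContDiffAt.mul ?_ (contDiffAt_velResponse hω hβ hne s)
  exact ContDiffAt.sqrt (by fun_prop) (by positivity)

/-- A `C¹` function is locally Lipschitz, hence Lipschitz on the compact rectangle, and bounded
there by continuity. -/
theorem exists_lipschitz_bound {f : ℝ → ℝ → ℝ} {u v : ℝ}
    (hf : ∀ b ∈ Icc u v, ∀ s, ContDiffAt ℝ 1 (fun p : ℝ × ℝ => f p.1 p.2) (b, s)) (T : ℝ) :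
    ∃ K : ℝ, 0 ≤ K ∧ ∀ b ∈ Icc u v, ∀ s ∈ Icc 0 T,
      |f b s| ≤ K ∧ ∀ b' ∈ Icc u v, |f b s - f b' s| ≤ K * |b - b'| := by
  have hcomp : IsCompact (Icc u v ×ˢ Icc 0 T) := isCompact_Icc.prod isCompact_Icc
  have hloc : LocallyLipschitzOn (Icc u v ×ˢ Icc 0 T) (fun p : ℝ × ℝ => f p.1 p.2) := by
    rintro ⟨b, s⟩ ⟨hb, hs⟩
    obtain ⟨K, t, ht, hK⟩ := (hf b hb s).exists_lipschitzOnWith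
    exact ⟨K, t, mem_nhdsWithin_of_mem_nhds ht, hK⟩
  obtain ⟨K, hK⟩ := hloc.exists_lipschitzOnWith_of_compact hcomp
  obtain ⟨M, hM⟩ := hcomp.exists_bound_of_continuousOn hK.continuousOn
  refine ⟨max K M, le_max_of_le_left K.2, fun b hb s hs => ⟨?_, fun b' hb' => ?_⟩⟩
  · exact (hM (b, s) ⟨hb, hs⟩).trans (le_max_right _ _)
  · have h := hK.dist_le_mul (b, s) ⟨hb, hs⟩ (b', s) ⟨hb', hs⟩
    rw [Real.dist_eq, Prod.dist_eq, dist_self, Real.dist_eq, max_eq_left (abs_nonneg _)] at h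
    exact h.trans (mul_le_mul_of_nonneg_right (le_max_left _ _) (abs_nonneg _))

theorem exists_noncritical_neighborhood (hβ : 0 < β) (hne : β ≠ 2 * ω) :
    ∃ δ : ℝ, 0 < δ ∧ ∀ b ∈ Icc (β - δ) (β + δ), 0 < b ∧ b ≠ 2 * ω := by
  have h : 0 < |β - 2 * ω| := abs_pos.2 (sub_ne_zero.2 hne)
  -- Half the distance to the nearer of `0` and `2 ω`, so that the closed interval avoids both.
  refine ⟨min β |β - 2 * ω| / 2, by positivity, fun b hb => ⟨?_, ?_⟩⟩
  · have := min_le_left β |β - 2 * ω|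
    linarith [hb.1]
  · rintro rfl
    have h1 := min_le_right β |β - 2 * ω|
    have h2 : |β - 2 * ω| ≤ min β |β - 2 * ω| / 2 :=
      abs_le.2 ⟨by linarith [hb.2], by linarith [hb.1]⟩
    linarith

theorem hasDerivAt_posKernel (hω : 0 < ω) (hβ : 0 < β) (hne : β ≠ 2 * ω) (s : ℝ) :
    HasDerivAt (posKernel ω kB Temp β) (velKernel ω kB Temp β s) s :=
  ((isImpulseResponse hω hβ hne).hasDerivAt_pos s).const_mul _

theorem hasDerivAt_velKernel (hω : 0 < ω) (hβ : 0 < β) (hne : β ≠ 2 * ω) (s : ℝ) :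
    HasDerivAt (velKernel ω kB Temp β)
      (-β * velKernel ω kB Temp β s - ω ^ 2 * posKernel ω kB Temp β s) s := by
  refine (((isImpulseResponse hω hβ hne).hasDerivAt_vel s).const_mul _).congr_deriv ?_
  simp only [velKernel, posKernel]
  ring

theorem posKernel_zero (hω : 0 < ω) (hβ : 0 < β) (hne : β ≠ 2 * ω) :
    posKernel ω kB Temp β 0 = 0 := by
  rw [posKernel, (isImpulseResponse hω hβ hne).pos_zero, mul_zero]

theorem velKernel_zero (hω : 0 < ω) (hβ : 0 < β) (hne : β ≠ 2 * ω) :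
    velKernel ω kB Temp β 0 = √(2 * β * kB * Temp) := by
  rw [velKernel, (isImpulseResponse hω hβ hne).vel_zero, mul_one]

theorem continuous_posKernel (hω : 0 < ω) (hβ : 0 < β) (hne : β ≠ 2 * ω) :
    Continuous (posKernel ω kB Temp β) :=
  continuous_iff_continuousAt.2 fun s => (hasDerivAt_posKernel hω hβ hne s).continuousAt

theorem continuous_velKernel (hω : 0 < ω) (hβ : 0 < β) (hne : β ≠ 2 * ω) :
    Continuous (velKernel ω kB Temp β) :=
  continuous_iff_continuousAt.2 fun s => (hasDerivAt_velKernel hω hβ hne s).continuousAt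

/-- Bounds and Lipschitz bounds in the friction for the two kernels and for the derivative of the
velocity kernel, uniform on `[0, T]` and for frictions near a non-critical friction. -/
theorem exists_kernel_bounds (hω : 0 < ω) (hkB : 0 < kB) (hTemp : 0 < Temp) (hβ : 0 < β)
    (hne : β ≠ 2 * ω) (T : ℝ) :
    ∃ δ K : ℝ, 0 < δ ∧ 0 ≤ K ∧ (∀ b ∈ Icc (β - δ) (β + δ), 0 < b ∧ b ≠ 2 * ω) ∧
      ∀ b ∈ Icc (β - δ) (β + δ), ∀ s ∈ Icc 0 T,
        |posKernel ω kB Temp b s| ≤ K ∧ |velKernel ω kB Temp b s| ≤ K ∧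
        ∀ b' ∈ Icc (β - δ) (β + δ),
          |posKernel ω kB Temp b s - posKernel ω kB Temp b' s| ≤ K * |b - b'| ∧
          |velKernel ω kB Temp b s - velKernel ω kB Temp b' s| ≤ K * |b - b'| ∧
          |(-b * velKernel ω kB Temp b s - ω ^ 2 * posKernel ω kB Temp b s)
            - (-b' * velKernel ω kB Temp b' s - ω ^ 2 * posKernel ω kB Temp b' s)|
            ≤ K * |b - b'| := by
  obtain ⟨δ, hδ, hok⟩ := exists_noncritical_neighborhood (ω := ω) hβ hne
  have hp := fun b hb s => contDiffAt_posKernel hω hkB hTemp (hok b hb).1 (hok b hb).2 s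
  have hv := fun b hb s => contDiffAt_velKernel hω hkB hTemp (hok b hb).1 (hok b hb).2 s
  obtain ⟨K₁, h1, hK₁⟩ := exists_lipschitz_bound hp T
  obtain ⟨K₂, h2, hK₂⟩ := exists_lipschitz_bound hv T
  obtain ⟨K₃, h3, hK₃⟩ := exists_lipschitz_bound
    (f := fun b s => -b * velKernel ω kB Temp b s - ω ^ 2 * posKernel ω kB Temp b s)
    (fun b hb s => (contDiffAt_fst.neg.mul (hv b hb s)).sub (contDiffAt_const.mul (hp b hb s))) T
  have l1 : K₁ ≤ K₁ + K₂ + K₃ := by linarith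
  have l2 : K₂ ≤ K₁ + K₂ + K₃ := by linarith
  have l3 : K₃ ≤ K₁ + K₂ + K₃ := by linarith
  refine ⟨δ, K₁ + K₂ + K₃, hδ, by positivity, hok, fun b hb s hs =>
    ⟨(hK₁ b hb s hs).1.trans l1, (hK₂ b hb s hs).1.trans l2, fun b' hb' => ⟨?_, ?_, ?_⟩⟩⟩
  · exact ((hK₁ b hb s hs).2 b' hb').trans (mul_le_mul_of_nonneg_right l1 (abs_nonneg _))
  · exact ((hK₂ b hb s hs).2 b' hb').trans (mul_le_mul_of_nonneg_right l2 (abs_nonneg _))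
  · exact ((hK₃ b hb s hs).2 b' hb').trans (mul_le_mul_of_nonneg_right l3 (abs_nonneg _))

theorem abs_integral_mul_le (hT : 0 < T) {f g : ℝ → ℝ} {A B : ℝ}
    (hf : ∀ s ∈ Icc 0 T, |f s| ≤ A) (hg : ∀ s ∈ Icc 0 T, |g s| ≤ B) :
    |∫ s in (0 : ℝ)..T, f s * g s| ≤ T * (A * B) := by
  have h := intervalIntegral.norm_integral_le_of_norm_le_const (a := 0) (b := T) (C := A * B)
    (f := fun s => f s * g s) (fun s hs => ?_)
  · rwa [Real.norm_eq_abs, sub_zero, abs_of_pos hT, mul_comm] at h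
  · rw [uIoc_of_le hT.le] at hs
    have hs' := Ioc_subset_Icc_self hs
    rw [norm_mul]
    exact mul_le_mul (hf s hs') (hg s hs') (abs_nonneg _) ((abs_nonneg _).trans (hf s hs'))

theorem integral_sq_le (hT : 0 < T) {f : ℝ → ℝ} {A : ℝ} (hf : ∀ s ∈ Icc 0 T, |f s| ≤ A) :
    ∫ s in (0 : ℝ)..T, f s ^ 2 ≤ T * A ^ 2 := by
  simp_rw [sq]
  exact (le_abs_self _).trans (abs_integral_mul_le hT hf hf)

/-- Integrates the pointwise bound `g² / 2 - (f - g)² ≤ f²`, which amounts to `(2 f - g)² ≥ 0`. -/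
theorem le_integral_sq_of_abs_sub_le (hT : 0 < T) {f g : ℝ → ℝ} {A : ℝ} (hf : Continuous f)
    (hg : Continuous g) (h : ∀ s ∈ Icc 0 T, |f s - g s| ≤ A) :
    (∫ s in (0 : ℝ)..T, g s ^ 2) / 2 - T * A ^ 2 ≤ ∫ s in (0 : ℝ)..T, f s ^ 2 := by
  have h1 : ∫ s in (0 : ℝ)..T, (g s ^ 2 / 2 - (f s - g s) ^ 2) ≤ ∫ s in (0 : ℝ)..T, f s ^ 2 := by
    refine intervalIntegral.integral_mono_on hT.le
      (Continuous.intervalIntegrable (by fun_prop) _ _)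
      (Continuous.intervalIntegrable (by fun_prop) _ _) fun s _ => ?_
    nlinarith [sq_nonneg (2 * f s - g s)]
  rw [intervalIntegral.integral_sub (Continuous.intervalIntegrable (by fun_prop) _ _)
    (Continuous.intervalIntegrable (by fun_prop) _ _), intervalIntegral.integral_div] at h1
  linarith [integral_sq_le hT h]

theorem integral_sq_pos (hT : 0 < T) {f : ℝ → ℝ} (hf : Continuous f)
    (h : ∃ s ∈ Icc 0 T, f s ≠ 0) : 0 < ∫ s in (0 : ℝ)..T, f s ^ 2 := by
  obtain ⟨s, hs, hfs⟩ := h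
  exact intervalIntegral.integral_pos hT (by fun_prop) (fun _ _ => sq_nonneg _)
    ⟨s, hs, by positivity⟩

theorem integral_velKernel_sq_pos (hω : 0 < ω) (hkB : 0 < kB) (hTemp : 0 < Temp) (hβ : 0 < β)
    (hne : β ≠ 2 * ω) (hT : 0 < T) :
    0 < ∫ s in (0 : ℝ)..T, velKernel ω kB Temp β s ^ 2 := by
  refine integral_sq_pos hT (continuous_velKernel hω hβ hne) ⟨0, ⟨le_rfl, hT.le⟩, ?_⟩
  rw [velKernel_zero hω hβ hne]
  positivity

theorem add_mul_le_of_le_deriv {f f' : ℝ → ℝ} {c τ : ℝ} (hf : ∀ s, HasDerivAt f (f' s) s)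
    (hc : ∀ s ∈ Icc 0 τ, c ≤ f' s) : ∀ s ∈ Icc 0 τ, f 0 + c * s ≤ f s := by
  intro s hs
  have h := (convex_Icc 0 τ).mul_sub_le_image_sub_of_le_deriv (f := f) (C := c)
    (fun s _ => (hf s).continuousAt.continuousWithinAt)
    (fun s _ => (hf s).differentiableAt.differentiableWithinAt)
    (fun s hs => by rw [(hf s).deriv]; exact hc s (interior_subset hs)) 0
    ⟨le_rfl, hs.1.trans hs.2⟩ s hs hs.1
  linarith

/-- If the kernel vanished on `[0, T]`, its one-sided derivative at `0` would be zero, whereas it is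
the noise coefficient `√(2 β kB Temp)`. -/
theorem integral_posKernel_sq_pos (hω : 0 < ω) (hkB : 0 < kB) (hTemp : 0 < Temp) (hβ : 0 < β)
    (hne : β ≠ 2 * ω) (hT : 0 < T) :
    0 < ∫ s in (0 : ℝ)..T, posKernel ω kB Temp β s ^ 2 := by
  refine integral_sq_pos hT (continuous_posKernel hω hβ hne) ?_
  by_contra! h
  have h0 : (0 : ℝ) ∈ Icc 0 T := ⟨le_rfl, hT.le⟩
  have hd := (hasDerivAt_posKernel (kB := kB) (Temp := Temp) hω hβ hne 0).hasDerivWithinAt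
    (s := Icc 0 T)
  have hz := (hasDerivWithinAt_const (0 : ℝ) (Icc 0 T) (0 : ℝ)).congr h (h 0 h0)
  have := (uniqueDiffOn_Icc hT 0 h0).eq_deriv _ hd hz
  rw [velKernel_zero hω hβ hne] at this
  exact absurd this (by positivity)

/-- The variances of the terminal values stay away from zero near a non-critical friction. -/
theorem exists_integral_kernel_sq_lower_bound (hω : 0 < ω) (hkB : 0 < kB) (hTemp : 0 < Temp)
    (hβ : 0 < β) (hne : β ≠ 2 * ω) (hT : 0 < T) :
    ∃ δ c : ℝ, 0 < δ ∧ 0 < c ∧ ∀ b ∈ Icc (β - δ) (β + δ),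
      c ≤ ∫ s in (0 : ℝ)..T, posKernel ω kB Temp b s ^ 2 ∧
      c ≤ ∫ s in (0 : ℝ)..T, velKernel ω kB Temp b s ^ 2 := by
  obtain ⟨δ, K, hδ, hK, hok, hbd⟩ := exists_kernel_bounds hω hkB hTemp hβ hne T
  have hp := integral_posKernel_sq_pos hω hkB hTemp hβ hne hT
  have hv := integral_velKernel_sq_pos hω hkB hTemp hβ hne hT
  set p := ∫ s in (0 : ℝ)..T, posKernel ω kB Temp β s ^ 2
  set v := ∫ s in (0 : ℝ)..T, velKernel ω kB Temp β s ^ 2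
  have hm : 0 < min p v := lt_min hp hv
  have hlim : Tendsto (fun d : ℝ => T * (K * d) ^ 2) (𝓝 0) (𝓝 0) := by
    have : Continuous (fun d : ℝ => T * (K * d) ^ 2) := by fun_prop
    simpa using this.tendsto 0
  -- Within distance `r` the perturbation costs at most a quarter of the minimum; half of each
  -- unperturbed integral survives, so a quarter of the minimum remains.
  obtain ⟨r, hr, hrlt⟩ := Metric.eventually_nhds_iff.1
    (hlim.eventually_lt_const (show 0 < min p v / 4 by positivity))
  refine ⟨min δ (r / 2), min p v / 4, by positivity, by positivity, fun b hb => ?_⟩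
  have hbδ : b ∈ Icc (β - δ) (β + δ) :=
    ⟨by linarith [hb.1, min_le_left δ (r / 2)], by linarith [hb.2, min_le_left δ (r / 2)]⟩
  have hβδ : β ∈ Icc (β - δ) (β + δ) := ⟨by linarith, by linarith⟩
  have hbr : |b - β| < r := by
    have := min_le_right δ (r / 2)
    exact abs_lt.2 ⟨by linarith [hb.1], by linarith [hb.2]⟩
  have hsmall := @hrlt |b - β| (by simpa using hbr)
  obtain ⟨hb0, hbne⟩ := hok b hbδ
  have e1 := le_integral_sq_of_abs_sub_le hT
    (continuous_posKernel (kB := kB) (Temp := Temp) hω hb0 hbne)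
    (continuous_posKernel hω hβ hne) (fun s hs => ((hbd b hbδ s hs).2.2 β hβδ).1)
  have e2 := le_integral_sq_of_abs_sub_le hT
    (continuous_velKernel (kB := kB) (Temp := Temp) hω hb0 hbne)
    (continuous_velKernel hω hβ hne) (fun s hs => ((hbd b hbδ s hs).2.2 β hβδ).2.1)
  have := min_le_left p v
  have := min_le_right p v
  constructor <;> linarith

/-- The position kernels at frictions `β ± ε` differ by at least a multiple of `ε` in mean
square. -/
theorem exists_integral_posKernel_sub_sq_lower_bound (hω : 0 < ω) (hkB : 0 < kB)
    (hTemp : 0 < Temp) (hβ : 0 < β) (hne : β ≠ 2 * ω) (hT : 0 < T) :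
    ∃ δ a : ℝ, 0 < δ ∧ 0 < a ∧ ∀ ε ∈ Ioo 0 δ, a * ε ^ 2 ≤
      ∫ s in (0 : ℝ)..T, (posKernel ω kB Temp (β + ε) s - posKernel ω kB Temp (β - ε) s) ^ 2 := by
  obtain ⟨δ, K, hδ, hK, hok, hbd⟩ := exists_kernel_bounds hω hkB hTemp hβ hne T
  -- Lower bound for the initial slope per unit of `ε`: with `A`, `B` the two noise coefficients,
  -- `A² - B² = 4 kB Temp ε` and `A + B ≤ 2 K`. The `+ 1` keeps the denominator positive.
  set a := 2 * kB * Temp / (K + 1) with ha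
  have ha0 : 0 < a := by positivity
  -- The slope changes at rate at most `2 K ε`, so up to time `τ` it loses at most half of its
  -- initial size `a ε`. The time `τ` does not depend on `ε`.
  set τ := min T (a / (4 * (K + 1))) with hτ
  have hτ0 : 0 < τ := by positivity
  have hτT : τ ≤ T := min_le_left _ _
  have hKτ : 2 * K * τ ≤ a / 2 := by
    have h1 : τ ≤ a / (4 * (K + 1)) := min_le_right _ _
    rw [le_div_iff₀ (by positivity)] at h1
    nlinarith
  -- The constant is `∫₀^τ (a s / 2)² ds`.
  refine ⟨δ, (a / 2) ^ 2 * (τ ^ 3 / 3), hδ, by positivity, fun ε hε => ?_⟩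
  have hb : β + ε ∈ Icc (β - δ) (β + δ) := ⟨by linarith [hε.1], by linarith [hε.2]⟩
  have hb' : β - ε ∈ Icc (β - δ) (β + δ) := ⟨by linarith [hε.2], by linarith [hε.1]⟩
  obtain ⟨h0, hn⟩ := hok _ hb
  obtain ⟨h0', hn'⟩ := hok _ hb'
  have habs : |(β + ε) - (β - ε)| = 2 * ε := by
    rw [show (β + ε) - (β - ε) = 2 * ε by ring, abs_of_pos (by linarith [hε.1])]
  set f := fun s => posKernel ω kB Temp (β + ε) s - posKernel ω kB Temp (β - ε) s with hf
  set f' := fun s => velKernel ω kB Temp (β + ε) s - velKernel ω kB Temp (β - ε) s with hf'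
  have hfd : ∀ s, HasDerivAt f (f' s) s := fun s =>
    (hasDerivAt_posKernel hω h0 hn s).sub (hasDerivAt_posKernel hω h0' hn' s)
  have hfd' := fun s => (hasDerivAt_velKernel (kB := kB) (Temp := Temp) hω h0 hn s).sub
    (hasDerivAt_velKernel (kB := kB) (Temp := Temp) hω h0' hn' s)
  have hf0 : f 0 = 0 := by
    simp only [hf, posKernel_zero hω h0 hn, posKernel_zero hω h0' hn', sub_self]
  have hT0 : (0 : ℝ) ∈ Icc 0 T := ⟨le_rfl, hT.le⟩
  have hf'0 : a * ε ≤ f' 0 := by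
    have b1 := (hbd _ hb 0 hT0).2.1
    have b2 := (hbd _ hb' 0 hT0).2.1
    simp only [hf']
    rw [velKernel_zero hω h0 hn] at b1 ⊢
    rw [velKernel_zero hω h0' hn'] at b2 ⊢
    have s1 := Real.sq_sqrt (show 0 ≤ 2 * (β + ε) * kB * Temp by positivity)
    have s2 := Real.sq_sqrt (show 0 ≤ 2 * (β - ε) * kB * Temp by positivity)
    set A := √(2 * (β + ε) * kB * Temp)
    set B := √(2 * (β - ε) * kB * Temp)
    have hA : A ≤ K := (le_abs_self _).trans b1
    have hB : B ≤ K := (le_abs_self _).trans b2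
    have hA0 : 0 < A := Real.sqrt_pos.2 (by positivity)
    have hB0 : 0 < B := Real.sqrt_pos.2 (by positivity)
    have hprod : (A - B) * (A + B) = 4 * kB * Temp * ε := by linear_combination s1 - s2
    have hAB : 0 < A - B := by
      refine pos_of_mul_pos_left (b := A + B) ?_ (by positivity)
      rw [hprod]
      have := hε.1
      positivity
    rw [ha, div_mul_eq_mul_div, div_le_iff₀ (by positivity)]
    nlinarith
  have hlow' : ∀ s ∈ Icc 0 τ, a / 2 * ε ≤ f' s := by
    intro s hs
    have h := add_mul_le_of_le_deriv (c := -(K * (2 * ε))) hfd' (τ := τ) (fun s hs => ?_) s hs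
    · have h1 : K * (2 * ε) * s ≤ a / 2 * ε := by
        have : K * s ≤ K * τ := mul_le_mul_of_nonneg_left hs.2 hK
        nlinarith [hε.1]
      have h2 : f' 0 + -(K * (2 * ε)) * s ≤ f' s := h
      linarith
    · have := ((hbd _ hb s ⟨hs.1, hs.2.trans hτT⟩).2.2 _ hb').2.2
      rw [habs] at this
      exact (abs_le.1 this).1
  have hlow : ∀ s ∈ Icc 0 τ, a / 2 * ε * s ≤ f s := by
    intro s hs
    have := add_mul_le_of_le_deriv hfd hlow' s hs
    rwa [hf0, zero_add] at this
  have hfc : Continuous f := continuous_iff_continuousAt.2 fun s => (hfd s).continuousAt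
  calc (a / 2) ^ 2 * (τ ^ 3 / 3) * ε ^ 2
      = ∫ s in (0 : ℝ)..τ, (a / 2 * ε * s) ^ 2 := by
        simp_rw [mul_pow]
        rw [intervalIntegral.integral_const_mul, integral_pow]
        norm_num
        ring
    _ ≤ ∫ s in (0 : ℝ)..τ, f s ^ 2 := by
        refine intervalIntegral.integral_mono_on hτ0.le
          (Continuous.intervalIntegrable (by fun_prop) _ _)
          (Continuous.intervalIntegrable (by fun_prop) _ _) fun s hs => ?_
        have := hs.1
        have := hε.1
        exact pow_le_pow_left₀ (by positivity) (hlow s hs) 2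
    _ ≤ ∫ s in (0 : ℝ)..T, f s ^ 2 := by
        refine intervalIntegral.integral_mono_interval le_rfl hτ0.le hτT
          (ae_of_all _ fun s => sq_nonneg _) (Continuous.intervalIntegrable (by fun_prop) _ _)

/-! ### Moments of the terminal values -/

section Moments

variable {x₀ v₀ β' : ℝ} {X V X' V' : ℝ → Ω → ℝ}

theorem IsCommonPathCoupling.moments [IsProbabilityMeasure P] (hω : 0 < ω) (hT : 0 < T)
    (hβ : 0 < β) (hne : β ≠ 2 * ω) (hβ' : 0 < β') (hne' : β' ≠ 2 * ω)
    (h : IsCommonPathCoupling ω kB Temp x₀ v₀ T β β' P X V X' V') :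
    (MemLp (X T) 2 P ∧ MemLp (V T) 2 P ∧ MemLp (X' T) 2 P ∧ MemLp (V' T) 2 P) ∧
    cov[X T, X' T; P]
      = ∫ s in (0 : ℝ)..T, posKernel ω kB Temp β s * posKernel ω kB Temp β' s ∧
    Var[X T; P] = ∫ s in (0 : ℝ)..T, posKernel ω kB Temp β s ^ 2 ∧
    Var[X' T; P] = ∫ s in (0 : ℝ)..T, posKernel ω kB Temp β' s ^ 2 ∧
    Var[X T - X' T; P]
      = ∫ s in (0 : ℝ)..T, (posKernel ω kB Temp β s - posKernel ω kB Temp β' s) ^ 2 ∧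
    Var[V T - V' T; P]
      = ∫ s in (0 : ℝ)..T, (velKernel ω kB Temp β s - velKernel ω kB Temp β' s) ^ 2 ∧
    cov[X T - X' T, V T - V' T; P]
      = ∫ s in (0 : ℝ)..T, (posKernel ω kB Temp β s - posKernel ω kB Temp β' s) *
          (velKernel ω kB Temp β s - velKernel ω kB Temp β' s) := by
  obtain ⟨B, hB, hX, hV, hX', hV'⟩ := h.exists_hasKernel hT (isImpulseResponse hω hβ hne)
    (isImpulseResponse hω hβ' hne')
  exact ⟨⟨hX.memLp hT hB, hV.memLp hT hB, hX'.memLp hT hB, hV'.memLp hT hB⟩,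
    hX.covariance hT hB hX', hX.variance hT hB, hX'.variance hT hB,
    (hX.sub hB hX').variance hT hB, (hV.sub hB hV').variance hT hB,
    (hX.sub hB hX').covariance hT hB (hV.sub hB hV')⟩

theorem IsIndependentCoupling.moments [IsProbabilityMeasure P] (hω : 0 < ω) (hT : 0 < T)
    (hβ : 0 < β) (hne : β ≠ 2 * ω) (hβ' : 0 < β') (hne' : β' ≠ 2 * ω)
    (h : IsIndependentCoupling ω kB Temp x₀ v₀ T β β' P X V X' V') :
    (MemLp (X T) 2 P ∧ MemLp (V T) 2 P ∧ MemLp (X' T) 2 P ∧ MemLp (V' T) 2 P) ∧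
    cov[X T, X' T; P] = 0 ∧
    Var[X T; P] = ∫ s in (0 : ℝ)..T, posKernel ω kB Temp β s ^ 2 ∧
    Var[X' T; P] = ∫ s in (0 : ℝ)..T, posKernel ω kB Temp β' s ^ 2 ∧
    Var[X T - X' T; P] = (∫ s in (0 : ℝ)..T, posKernel ω kB Temp β s ^ 2)
      + ∫ s in (0 : ℝ)..T, posKernel ω kB Temp β' s ^ 2 ∧
    Var[V T - V' T; P] = (∫ s in (0 : ℝ)..T, velKernel ω kB Temp β s ^ 2)
      + ∫ s in (0 : ℝ)..T, velKernel ω kB Temp β' s ^ 2 ∧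
    cov[X T - X' T, V T - V' T; P]
      = (∫ s in (0 : ℝ)..T, posKernel ω kB Temp β s * velKernel ω kB Temp β s)
        + ∫ s in (0 : ℝ)..T, posKernel ω kB Temp β' s * velKernel ω kB Temp β' s := by
  obtain ⟨B, B', hB, hB', hind, hX, hV, hX', hV'⟩ :=
    h.exists_hasKernel hT (isImpulseResponse hω hβ hne) (isImpulseResponse hω hβ' hne')
  have mX := hX.memLp hT hB
  have mV := hV.memLp hT hB
  have mX' := hX'.memLp hT hB'
  have mV' := hV'.memLp hT hB'
  have cXX := hX.covariance_eq_zero hT hB hB' hind hX'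
  have cVV := hV.covariance_eq_zero hT hB hB' hind hV'
  have cXV := hX.covariance_eq_zero hT hB hB' hind hV'
  have cVX := hV.covariance_eq_zero hT hB hB' hind hX'
  refine ⟨⟨mX, mV, mX', mV'⟩, cXX, hX.variance hT hB, hX'.variance hT hB', ?_, ?_, ?_⟩
  · rw [variance_sub mX mX', cXX, hX.variance hT hB, hX'.variance hT hB']
    simp [posKernel]
  · rw [variance_sub mV mV', cVV, hV.variance hT hB, hV'.variance hT hB']
    simp [velKernel]
  · rw [covariance_sub_sub mX mX' mV mV', cXV, covariance_comm (X' T) (V T), cVX,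
      hX.covariance hT hB hV, hX'.covariance hT hB' hV']
    simp [posKernel, velKernel]

theorem ofReal_integral_posKernel_sq (hω : 0 < ω) (hkB : 0 < kB) (hTemp : 0 < Temp) (hβ : 0 < β)
    (T : ℝ) : ((∫ s in (0 : ℝ)..T, posKernel ω kB Temp β s ^ 2 : ℝ) : ℂ)
      = psi (2 * kB * Temp) T (mu₁ ω β) (mu₂ ω β) := by
  simp_rw [sq]
  exact ofReal_integral_posKernel_mul hω hkB hTemp hβ hβ T

end Moments

/-! ### Asymptotics of the differences -/

section Asymptotics

theorem exists_bound_of_isBigO {f : ℝ → ℂ} {n : ℕ} (h : f =O[𝓝 0] (fun ε : ℝ => ε ^ n)) :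
    ∃ C δ : ℝ, 0 < C ∧ 0 < δ ∧ ∀ ε : ℝ, |ε| < δ → ‖f ε‖ ≤ C * |ε| ^ n := by
  obtain ⟨C, hC, hb⟩ := h.exists_pos
  obtain ⟨δ, hδ, hlt⟩ := Metric.eventually_nhds_iff.1 hb.bound
  refine ⟨C, δ, hC, hδ, fun ε hε => ?_⟩
  simpa using @hlt ε (by simpa using hε)

theorem nonpos_of_le_mul_small {x C δ : ℝ} (hδ : 0 < δ) (h : ∀ ε ∈ Ioo 0 δ, x ≤ C * ε) :
    x ≤ 0 := by
  have hlim : Tendsto (fun ε : ℝ => C * ε) (𝓝[>] 0) (𝓝 0) := by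
    have : Continuous (fun ε : ℝ => C * ε) := by fun_prop
    simpa using (this.tendsto 0).mono_left nhdsWithin_le_nhds
  refine ge_of_tendsto hlim ?_
  filter_upwards [Ioo_mem_nhdsGT hδ] with ε hε using h ε hε

/-- A complex quadratic coefficient of a real function with a quadratic lower bound is real and
positive. -/
theorem pos_of_quadratic_expansion {D : ℝ → ℝ} {z : ℂ} {C δ a : ℝ} (hδ : 0 < δ) (ha : 0 < a)
    (hD : ∀ ε ∈ Ioo 0 δ, ‖(D ε : ℂ) - z * ε ^ 2‖ ≤ C * ε ^ 3)
    (hlow : ∀ ε ∈ Ioo 0 δ, a * ε ^ 2 ≤ D ε) : 0 < z.re ∧ (z.re : ℂ) = z := by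
  have split : ∀ ε : ℝ, ((D ε : ℂ) - z * ε ^ 2).re = D ε - z.re * ε ^ 2 ∧
      ((D ε : ℂ) - z * ε ^ 2).im = -(z.im * ε ^ 2) := by
    intro ε
    have : z * (ε : ℂ) ^ 2 = z * ((ε ^ 2 : ℝ) : ℂ) := by push_cast; ring
    rw [this, Complex.sub_re, Complex.sub_im, Complex.re_mul_ofReal, Complex.im_mul_ofReal]
    simp
  constructor
  · have : a - z.re ≤ 0 := by
      refine nonpos_of_le_mul_small (C := C) hδ fun ε hε => ?_
      have h1 := (Complex.abs_re_le_norm _).trans (hD ε hε)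
      rw [(split ε).1] at h1
      have h2 := (le_abs_self _).trans h1
      have h3 := hlow ε hε
      have h4 : (a - z.re) * ε ^ 2 ≤ (C * ε) * ε ^ 2 := by linarith
      exact le_of_mul_le_mul_right h4 (pow_pos hε.1 2)
    linarith
  · have : |z.im| ≤ 0 := by
      refine nonpos_of_le_mul_small (C := C) hδ fun ε hε => ?_
      have h1 := (Complex.abs_im_le_norm _).trans (hD ε hε)
      rw [(split ε).2, abs_neg, abs_mul, abs_of_nonneg (sq_nonneg ε)] at h1
      have h4 : |z.im| * ε ^ 2 ≤ (C * ε) * ε ^ 2 := by linarith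
      exact le_of_mul_le_mul_right h4 (pow_pos hε.1 2)
    exact Complex.ext rfl (by simpa using (abs_nonpos_iff.1 this).symm)

theorem psiPert_eq_integral (hω : 0 < ω) (hkB : 0 < kB) (hTemp : 0 < Temp) {ε : ℝ}
    (hpos : 0 < β + ε) : psiPert (2 * kB * Temp) T ω β ε
      = ((∫ s in (0 : ℝ)..T, posKernel ω kB Temp (β + ε) s ^ 2 : ℝ) : ℂ) :=
  (ofReal_integral_posKernel_sq hω hkB hTemp hpos T).symm

/-- The mean square difference of the position kernels at frictions `β ± ε`. -/
theorem ofReal_integral_posKernel_sub_sq (hω : 0 < ω) (hkB : 0 < kB) (hTemp : 0 < Temp) {ε : ℝ}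
    (hp : 0 < β + ε) (hne : β + ε ≠ 2 * ω) (hp' : 0 < β - ε) (hne' : β - ε ≠ 2 * ω) :
    ((∫ s in (0 : ℝ)..T,
        (posKernel ω kB Temp (β + ε) s - posKernel ω kB Temp (β - ε) s) ^ 2 : ℝ) : ℂ)
      = psiPert (2 * kB * Temp) T ω β ε + psiPert (2 * kB * Temp) T ω β (-ε)
        - 2 * phiPert (2 * kB * Temp) T ω β ε := by
  have hc := continuous_posKernel (kB := kB) (Temp := Temp) hω hp hne
  have hc' := continuous_posKernel (kB := kB) (Temp := Temp) hω hp' hne'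
  rw [psiPert_eq_integral hω hkB hTemp hp,
    psiPert_eq_integral hω hkB hTemp (by rwa [← sub_eq_add_neg]), ← sub_eq_add_neg, phiPert,
    ← ofReal_integral_posKernel_mul hω hkB hTemp hp hp' T]
  have : ∀ s, (posKernel ω kB Temp (β + ε) s - posKernel ω kB Temp (β - ε) s) ^ 2
      = posKernel ω kB Temp (β + ε) s ^ 2 + posKernel ω kB Temp (β - ε) s ^ 2
        - 2 * (posKernel ω kB Temp (β + ε) s * posKernel ω kB Temp (β - ε) s) := fun s => by ring
  simp_rw [this]
  rw [intervalIntegral.integral_sub (Continuous.intervalIntegrable (by fun_prop) _ _)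
    (Continuous.intervalIntegrable (by fun_prop) _ _),
    intervalIntegral.integral_add (Continuous.intervalIntegrable (by fun_prop) _ _)
    (Continuous.intervalIntegrable (by fun_prop) _ _), intervalIntegral.integral_const_mul]
  push_cast
  ring

/-- The first order terms at `ε` and `-ε` cancel in the sum. -/
theorem psiPert_add_psiPert_neg_isBigO {γ : ℝ} (hω : 0 < ω) (hβ : 0 < β) (hne : β ≠ 2 * ω) :
    (fun ε : ℝ => psiPert γ T ω β ε + psiPert γ T ω β (-ε) - 2 * psiPert γ T ω β 0
        - iteratedDeriv 2 (psiPert γ T ω β) 0 * ε ^ 2) =O[𝓝 0] (fun ε : ℝ => ε ^ 3) := by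
  have h := contDiffAt_psiPert (n := 3) (γ := γ) (T := T) hω hβ hne
  refine ((taylor_two_isBigO h).add (taylor_two_neg_isBigO h)).congr_left fun ε => ?_
  ring

/-- The second order expansion of the variance of the central difference, common path. -/
theorem exists_central_common_expansion (hω : 0 < ω) (hkB : 0 < kB) (hTemp : 0 < Temp)
    (hβ : 0 < β) (hne : β ≠ 2 * ω) (hT : 0 < T) :
    ∃ c : ℝ, 0 < c ∧
      (c : ℂ) = iteratedDeriv 2 (psiPert (2 * kB * Temp) T ω β) 0
        - iteratedDeriv 2 (phiPert (2 * kB * Temp) T ω β) 0 ∧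
      ∃ C δ : ℝ, 0 < δ ∧ ∀ ε : ℝ, |ε| < δ →
        (0 < β + ε ∧ β + ε ≠ 2 * ω) ∧ (0 < β - ε ∧ β - ε ≠ 2 * ω) ∧
        |(∫ s in (0 : ℝ)..T,
          (posKernel ω kB Temp (β + ε) s - posKernel ω kB Temp (β - ε) s) ^ 2) - c * ε ^ 2|
          ≤ C * |ε| ^ 3 := by
  set γ := 2 * kB * Temp with hγ
  set z := iteratedDeriv 2 (psiPert γ T ω β) 0 - iteratedDeriv 2 (phiPert γ T ω β) 0 with hz
  set D : ℝ → ℝ := fun ε => ∫ s in (0 : ℝ)..T,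
    (posKernel ω kB Temp (β + ε) s - posKernel ω kB Temp (β - ε) s) ^ 2 with hD
  have hbig : (fun ε : ℝ => psiPert γ T ω β ε + psiPert γ T ω β (-ε) - 2 * phiPert γ T ω β ε
      - z * ε ^ 2) =O[𝓝 0] (fun ε : ℝ => ε ^ 3) := by
    have h1 := psiPert_add_psiPert_neg_isBigO (γ := γ) (T := T) hω hβ hne
    have h2 := (taylor_two_isBigO
      (contDiffAt_phiPert (n := 3) (γ := γ) (T := T) hω hβ hne)).const_mul_left 2
    refine (h1.sub h2).congr_left fun ε => ?_
    -- The zeroth order cancels because `ψ(0) = φ(0)`, and the first because `φ'(0) = 0`.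
    rw [deriv_phiPert, psiPert_zero, hz]
    ring
  obtain ⟨C, δ₁, hC, hδ₁, hbound⟩ := exists_bound_of_isBigO hbig
  obtain ⟨δ₂, hδ₂, hok⟩ := exists_noncritical_neighborhood (ω := ω) hβ hne
  obtain ⟨δ₃, a, hδ₃, ha, hlow⟩ :=
    exists_integral_posKernel_sub_sq_lower_bound hω hkB hTemp hβ hne hT
  have hok' : ∀ ε : ℝ, |ε| < δ₂ →
      (0 < β + ε ∧ β + ε ≠ 2 * ω) ∧ (0 < β - ε ∧ β - ε ≠ 2 * ω) := by
    intro ε hε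
    rw [abs_lt] at hε
    exact ⟨hok _ ⟨by linarith, by linarith⟩, hok _ ⟨by linarith, by linarith⟩⟩
  have hexp : ∀ ε : ℝ, |ε| < min δ₁ δ₂ → ‖(D ε : ℂ) - z * ε ^ 2‖ ≤ C * |ε| ^ 3 := by
    intro ε hε
    obtain ⟨⟨p, n⟩, p', n'⟩ := hok' ε (hε.trans_le (min_le_right _ _))
    rw [hD, ofReal_integral_posKernel_sub_sq hω hkB hTemp p n p' n']
    exact hbound ε (hε.trans_le (min_le_left _ _))
  have hδ : 0 < min (min δ₁ δ₂) δ₃ := lt_min (lt_min hδ₁ hδ₂) hδ₃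
  -- The expansion only provides a complex coefficient `z`. Since `D` is real and bounded below by
  -- `a ε²`, dividing by `ε²` and letting `ε` decrease to `0` shows that `z` is real and at least
  -- `a`.
  obtain ⟨hpos, hre⟩ := pos_of_quadratic_expansion (D := D) (z := z) (C := C) hδ ha
    (fun ε hε => by
      have := hexp ε (by rw [abs_of_pos hε.1]; exact hε.2.trans_le (min_le_left _ _))
      rwa [abs_of_pos hε.1] at this)
    (fun ε hε => hlow ε ⟨hε.1, hε.2.trans_le (min_le_right _ _)⟩)
  refine ⟨z.re, hpos, hre, C, min δ₁ δ₂, lt_min hδ₁ hδ₂, fun ε hε => ?_⟩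
  obtain ⟨ok, ok'⟩ := hok' ε (hε.trans_le (min_le_right _ _))
  refine ⟨ok, ok', ?_⟩
  have h := hexp ε hε
  rw [← hre] at h
  have hcast : (D ε : ℂ) - (z.re : ℂ) * (ε : ℂ) ^ 2 = ((D ε - z.re * ε ^ 2 : ℝ) : ℂ) := by
    push_cast
    ring
  rwa [hcast, Complex.norm_real, Real.norm_eq_abs] at h

/-- The expansion of the variance of the central difference, independent paths. -/
theorem exists_central_independent_expansion (hω : 0 < ω) (hkB : 0 < kB) (hTemp : 0 < Temp)
    (hβ : 0 < β) (hne : β ≠ 2 * ω) (hT : 0 < T) :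
    ∃ v : ℝ, 0 < v ∧ (v : ℂ) = psiPert (2 * kB * Temp) T ω β 0 ∧
      ∃ C δ : ℝ, 0 < δ ∧ ∀ ε : ℝ, |ε| < δ →
        (0 < β + ε ∧ β + ε ≠ 2 * ω) ∧ (0 < β - ε ∧ β - ε ≠ 2 * ω) ∧
        |(∫ s in (0 : ℝ)..T, posKernel ω kB Temp (β + ε) s ^ 2)
          + (∫ s in (0 : ℝ)..T, posKernel ω kB Temp (β - ε) s ^ 2) - 2 * v| ≤ C * ε ^ 2 := by
  set γ := 2 * kB * Temp with hγ
  have hv := integral_posKernel_sq_pos hω hkB hTemp hβ hne hT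
  have hψ : ((∫ s in (0 : ℝ)..T, posKernel ω kB Temp β s ^ 2 : ℝ) : ℂ) = psiPert γ T ω β 0 := by
    rw [psiPert_eq_integral hω hkB hTemp (by simpa), add_zero]
  set v := ∫ s in (0 : ℝ)..T, posKernel ω kB Temp β s ^ 2
  set z := iteratedDeriv 2 (psiPert γ T ω β) 0 with hz
  obtain ⟨C, δ₁, hC, hδ₁, hbound⟩ := exists_bound_of_isBigO
    (psiPert_add_psiPert_neg_isBigO (γ := γ) (T := T) hω hβ hne)
  obtain ⟨δ₂, hδ₂, hok⟩ := exists_noncritical_neighborhood (ω := ω) hβ hne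
  -- The cap `1` on the radius gives `|ε|³ ≤ ε²`, so the cubic remainder and the quadratic term
  -- merge into one `O(ε²)` bound.
  refine ⟨v, hv, hψ, C + ‖z‖, min (min δ₁ δ₂) 1, by positivity, fun ε hε => ?_⟩
  have hε₁ : |ε| < δ₁ := hε.trans_le ((min_le_left _ _).trans (min_le_left _ _))
  have hε₂ : |ε| < δ₂ := hε.trans_le ((min_le_left _ _).trans (min_le_right _ _))
  have hε₃ : |ε| ≤ 1 := (hε.trans_le (min_le_right _ _)).le
  have hε₂' := abs_lt.1 hε₂
  have ok : 0 < β + ε ∧ β + ε ≠ 2 * ω := hok _ ⟨by linarith, by linarith⟩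
  have ok' : 0 < β - ε ∧ β - ε ≠ 2 * ω := hok _ ⟨by linarith, by linarith⟩
  refine ⟨ok, ok', ?_⟩
  have h := hbound ε hε₁
  have hcube : |ε| ^ 3 ≤ ε ^ 2 := by
    rw [← sq_abs ε]
    exact pow_le_pow_of_le_one (abs_nonneg _) hε₃ (by norm_num)
  have hsum : ‖psiPert γ T ω β ε + psiPert γ T ω β (-ε) - 2 * psiPert γ T ω β 0‖
      ≤ (C + ‖z‖) * ε ^ 2 := by
    have h1 := norm_le_norm_sub_add
      (psiPert γ T ω β ε + psiPert γ T ω β (-ε) - 2 * psiPert γ T ω β 0) (z * (ε : ℂ) ^ 2)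
    have h2 : ‖z * (ε : ℂ) ^ 2‖ = ‖z‖ * ε ^ 2 := by
      rw [norm_mul, norm_pow, Complex.norm_real, Real.norm_eq_abs, sq_abs]
    have h3 := mul_le_mul_of_nonneg_left hcube hC.le
    rw [h2] at h1
    linarith
  rw [← hψ, psiPert_eq_integral hω hkB hTemp ok.1,
    psiPert_eq_integral hω hkB hTemp (by rw [← sub_eq_add_neg]; exact ok'.1),
    ← sub_eq_add_neg] at hsum
  rw [← Real.norm_eq_abs, ← Complex.norm_real]
  push_cast
  exact hsum

theorem abs_le_of_mem_standardDifferences {d : ℝ × ℝ} (hd : d ∈ standardDifferences) :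
    |d.1| ≤ 1 ∧ |d.2| ≤ 1 := by
  rcases hd with rfl | rfl | rfl <;> simp

/-- Bounds for the second moments of the differences, in terms of the kernels. -/
theorem exists_difference_bounds (hω : 0 < ω) (hkB : 0 < kB) (hTemp : 0 < Temp)
    (hβ : 0 < β) (hne : β ≠ 2 * ω) (hT : 0 < T) :
    ∃ c C δ : ℝ, 0 < c ∧ 0 < δ ∧ ∀ d₁ d₂ ε : ℝ, |d₁| ≤ 1 → |d₂| ≤ 1 → |ε| < δ →
      ∀ b b' : ℝ, b = β + d₁ * ε → b' = β + d₂ * ε →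
      (0 < b ∧ b ≠ 2 * ω) ∧ (0 < b' ∧ b' ≠ 2 * ω) ∧
      (∫ s in (0 : ℝ)..T, (posKernel ω kB Temp b s - posKernel ω kB Temp b' s) ^ 2)
        ≤ C * ε ^ 2 ∧
      (∫ s in (0 : ℝ)..T, (velKernel ω kB Temp b s - velKernel ω kB Temp b' s) ^ 2)
        ≤ C * ε ^ 2 ∧
      |∫ s in (0 : ℝ)..T, (posKernel ω kB Temp b s - posKernel ω kB Temp b' s) *
        (velKernel ω kB Temp b s - velKernel ω kB Temp b' s)| ≤ C * ε ^ 2 ∧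
      ∀ e ∈ ({b, b'} : Set ℝ),
        c ≤ (∫ s in (0 : ℝ)..T, posKernel ω kB Temp e s ^ 2) ∧
        (∫ s in (0 : ℝ)..T, posKernel ω kB Temp e s ^ 2) ≤ C ∧
        c ≤ (∫ s in (0 : ℝ)..T, velKernel ω kB Temp e s ^ 2) ∧
        (∫ s in (0 : ℝ)..T, velKernel ω kB Temp e s ^ 2) ≤ C ∧
        |∫ s in (0 : ℝ)..T, posKernel ω kB Temp e s * velKernel ω kB Temp e s| ≤ C := by
  obtain ⟨δ₁, K, hδ₁, hK, hok, hbd⟩ := exists_kernel_bounds hω hkB hTemp hβ hne T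
  obtain ⟨δ₂, c, hδ₂, hc, hlow⟩ :=
    exists_integral_kernel_sq_lower_bound hω hkB hTemp hβ hne hT
  -- The two frictions differ by at most `2 |ε|`, so squared differences of kernels are at most `4
  -- K² ε²`. The same constant dominates the bound `T K²` for a single kernel.
  refine ⟨c, 4 * (T * K ^ 2), min δ₁ δ₂, hc, lt_min hδ₁ hδ₂, ?_⟩
  intro d₁ d₂ ε hd₁ hd₂ hε b b' hb hb'
  have mem : ∀ d : ℝ, |d| ≤ 1 → ∀ δ, |ε| < δ → β + d * ε ∈ Icc (β - δ) (β + δ) := by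
    intro d hd δ hδ
    have h : |d * ε| ≤ |ε| := by
      rw [abs_mul]
      exact mul_le_of_le_one_left (abs_nonneg _) hd
    have := abs_le.1 (h.trans hδ.le)
    exact ⟨by linarith [this.1], by linarith [this.2]⟩
  have hε₁ : |ε| < δ₁ := hε.trans_le (min_le_left _ _)
  have hε₂ : |ε| < δ₂ := hε.trans_le (min_le_right _ _)
  have m := mem d₁ hd₁ δ₁ hε₁
  have m' := mem d₂ hd₂ δ₁ hε₁
  have q := mem d₁ hd₁ δ₂ hε₂
  have q' := mem d₂ hd₂ δ₂ hε₂
  rw [← hb] at m q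
  rw [← hb'] at m' q'
  have hdiff : K * |b - b'| ≤ K * (2 * |ε|) := by
    refine mul_le_mul_of_nonneg_left ?_ hK
    have h1 : b - b' = (d₁ - d₂) * ε := by rw [hb, hb']; ring
    rw [h1, abs_mul]
    refine mul_le_mul_of_nonneg_right ?_ (abs_nonneg _)
    linarith [abs_sub d₁ d₂]
  have hp : ∀ s ∈ Icc 0 T, |posKernel ω kB Temp b s - posKernel ω kB Temp b' s|
      ≤ K * (2 * |ε|) := fun s hs => ((hbd b m s hs).2.2 b' m').1.trans hdiff
  have hv : ∀ s ∈ Icc 0 T, |velKernel ω kB Temp b s - velKernel ω kB Temp b' s|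
      ≤ K * (2 * |ε|) := fun s hs => ((hbd b m s hs).2.2 b' m').2.1.trans hdiff
  have hconst : T * (K * (2 * |ε|)) ^ 2 = 4 * (T * K ^ 2) * ε ^ 2 := by
    rw [← sq_abs ε]
    ring
  refine ⟨hok b m, hok b' m', (integral_sq_le hT hp).trans hconst.le,
    (integral_sq_le hT hv).trans hconst.le,
    (abs_integral_mul_le hT hp hv).trans (by rw [← sq, hconst]), ?_⟩
  have hC : T * K ^ 2 ≤ 4 * (T * K ^ 2) := by
    have : 0 ≤ T * K ^ 2 := by positivity
    linarith
  have bounds : ∀ e ∈ Icc (β - δ₁) (β + δ₁), e ∈ Icc (β - δ₂) (β + δ₂) →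
      c ≤ (∫ s in (0 : ℝ)..T, posKernel ω kB Temp e s ^ 2) ∧
        (∫ s in (0 : ℝ)..T, posKernel ω kB Temp e s ^ 2) ≤ 4 * (T * K ^ 2) ∧
        c ≤ (∫ s in (0 : ℝ)..T, velKernel ω kB Temp e s ^ 2) ∧
        (∫ s in (0 : ℝ)..T, velKernel ω kB Temp e s ^ 2) ≤ 4 * (T * K ^ 2) ∧
        |∫ s in (0 : ℝ)..T, posKernel ω kB Temp e s * velKernel ω kB Temp e s|
          ≤ 4 * (T * K ^ 2) := fun e he he' =>
    ⟨(hlow e he').1, (integral_sq_le hT fun s hs => (hbd e he s hs).1).trans hC, (hlow e he').2,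
      (integral_sq_le hT fun s hs => (hbd e he s hs).2.1).trans hC,
      (abs_integral_mul_le hT (fun s hs => (hbd e he s hs).1)
        (fun s hs => (hbd e he s hs).2.1)).trans (by rw [← sq]; exact hC)⟩
  rintro e (rfl | rfl)
  · exact bounds _ m q
  · exact bounds _ m' q'

end Asymptotics

end Langevin

end

theorem mainTheorem4 (ω kB Temp x₀ v₀ T : ℝ)
    (hω : 0 < ω) (hkB : 0 < kB) (hTemp : 0 < Temp) (hT : 0 < T) :
    -- `μ₁, μ₂` are the eigenvalues of the drift matrix, with multiplicity
    (∀ β : ℝ, ((Langevin.driftMatrix ω β).map (algebraMap ℝ ℂ)).charpoly.roots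
        = {Langevin.mu₁ ω β, Langevin.mu₂ ω β}) ∧
    -- the position covariances in terms of the eigenvalues
    (∀ β β' : ℝ, 0 < β → β ≠ 2 * ω → 0 < β' → β' ≠ 2 * ω →
      ∀ (Ω : Type u) [MeasurableSpace Ω] (P : Measure Ω) [IsProbabilityMeasure P]
        (X V X' V' : ℝ → Ω → ℝ),
        (Langevin.IsCommonPathCoupling ω kB Temp x₀ v₀ T β β' P X V X' V' →
          (MemLp (X T) 2 P ∧ MemLp (V T) 2 P ∧ MemLp (X' T) 2 P ∧ MemLp (V' T) 2 P) ∧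
          ((cov[X T, X' T; P] : ℝ) : ℂ) = Langevin.phi (2 * kB * Temp) T
            (Langevin.mu₁ ω β) (Langevin.mu₂ ω β) (Langevin.mu₁ ω β') (Langevin.mu₂ ω β') ∧
          ((Var[X T; P] : ℝ) : ℂ)
            = Langevin.psi (2 * kB * Temp) T (Langevin.mu₁ ω β) (Langevin.mu₂ ω β) ∧
          ((Var[X' T; P] : ℝ) : ℂ)
            = Langevin.psi (2 * kB * Temp) T (Langevin.mu₁ ω β') (Langevin.mu₂ ω β')) ∧
        (Langevin.IsIndependentCoupling ω kB Temp x₀ v₀ T β β' P X V X' V' →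
          (MemLp (X T) 2 P ∧ MemLp (V T) 2 P ∧ MemLp (X' T) 2 P ∧ MemLp (V' T) 2 P) ∧
          cov[X T, X' T; P] = 0 ∧
          ((Var[X T; P] : ℝ) : ℂ)
            = Langevin.psi (2 * kB * Temp) T (Langevin.mu₁ ω β) (Langevin.mu₂ ω β) ∧
          ((Var[X' T; P] : ℝ) : ℂ)
            = Langevin.psi (2 * kB * Temp) T (Langevin.mu₁ ω β') (Langevin.mu₂ ω β'))) ∧
    -- the sensitivity with respect to the friction
    (∀ β : ℝ, 0 < β → β ≠ 2 * ω →
      -- expansions of the variances and of the covariance for the central difference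
      ContDiffAt ℝ 3 (Langevin.psiPert (2 * kB * Temp) T ω β) 0 ∧
      ContDiffAt ℝ 3 (Langevin.phiPert (2 * kB * Temp) T ω β) 0 ∧
      (fun ε : ℝ => Langevin.psiPert (2 * kB * Temp) T ω β ε
          - (Langevin.psiPert (2 * kB * Temp) T ω β 0
            + deriv (Langevin.psiPert (2 * kB * Temp) T ω β) 0 * ε
            + iteratedDeriv 2 (Langevin.psiPert (2 * kB * Temp) T ω β) 0 / 2 * ε ^ 2))
        =O[𝓝 0] (fun ε : ℝ => ε ^ 3) ∧
      (fun ε : ℝ => Langevin.psiPert (2 * kB * Temp) T ω β (-ε)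
          - (Langevin.psiPert (2 * kB * Temp) T ω β 0
            - deriv (Langevin.psiPert (2 * kB * Temp) T ω β) 0 * ε
            + iteratedDeriv 2 (Langevin.psiPert (2 * kB * Temp) T ω β) 0 / 2 * ε ^ 2))
        =O[𝓝 0] (fun ε : ℝ => ε ^ 3) ∧
      (fun ε : ℝ => Langevin.phiPert (2 * kB * Temp) T ω β ε
          - (Langevin.phiPert (2 * kB * Temp) T ω β 0
            + deriv (Langevin.phiPert (2 * kB * Temp) T ω β) 0 * ε
            + iteratedDeriv 2 (Langevin.phiPert (2 * kB * Temp) T ω β) 0 / 2 * ε ^ 2))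
        =O[𝓝 0] (fun ε : ℝ => ε ^ 3) ∧
      -- the zeroth and first order terms
      Langevin.psiPert (2 * kB * Temp) T ω β 0 = Langevin.phiPert (2 * kB * Temp) T ω β 0 ∧
      deriv (Langevin.phiPert (2 * kB * Temp) T ω β) 0 = 0 ∧
      -- central difference, common path: `Var[X_T - X'_T] = c ε² + O(ε³)` with `c > 0`
      (∃ c : ℝ, 0 < c ∧
        (c : ℂ) = iteratedDeriv 2 (Langevin.psiPert (2 * kB * Temp) T ω β) 0
          - iteratedDeriv 2 (Langevin.phiPert (2 * kB * Temp) T ω β) 0 ∧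
        ∃ C δ : ℝ, 0 < δ ∧ ∀ ε : ℝ, |ε| < δ →
          ∀ (Ω : Type u) [MeasurableSpace Ω] (P : Measure Ω) [IsProbabilityMeasure P]
            (X V X' V' : ℝ → Ω → ℝ),
            Langevin.IsCommonPathCoupling ω kB Temp x₀ v₀ T (β + ε) (β - ε) P X V X' V' →
            |Var[X T - X' T; P] - c * ε ^ 2| ≤ C * |ε| ^ 3) ∧
      -- central difference, independent paths: `Var[X_T - X'_T] = 2 v + O(ε²)` with `v > 0`
      (∃ v : ℝ, 0 < v ∧ (v : ℂ) = Langevin.psiPert (2 * kB * Temp) T ω β 0 ∧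
        ∃ C δ : ℝ, 0 < δ ∧ ∀ ε : ℝ, |ε| < δ →
          ∀ (Ω : Type u) [MeasurableSpace Ω] (P : Measure Ω) [IsProbabilityMeasure P]
            (X V X' V' : ℝ → Ω → ℝ),
            Langevin.IsIndependentCoupling ω kB Temp x₀ v₀ T (β + ε) (β - ε) P X V X' V' →
            |Var[X T - X' T; P] - 2 * v| ≤ C * ε ^ 2) ∧
      -- all standard differences, all entries of the covariance matrix of the difference
      (∀ d ∈ Langevin.standardDifferences,
        ∃ c C δ : ℝ, 0 < c ∧ 0 < δ ∧ ∀ ε : ℝ, |ε| < δ →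
          ∀ (Ω : Type u) [MeasurableSpace Ω] (P : Measure Ω) [IsProbabilityMeasure P]
            (X V X' V' : ℝ → Ω → ℝ),
            (Langevin.IsCommonPathCoupling ω kB Temp x₀ v₀ T
                (β + d.1 * ε) (β + d.2 * ε) P X V X' V' →
              Var[X T - X' T; P] ≤ C * ε ^ 2 ∧ Var[V T - V' T; P] ≤ C * ε ^ 2 ∧
              |cov[X T - X' T, V T - V' T; P]| ≤ C * ε ^ 2) ∧
            (Langevin.IsIndependentCoupling ω kB Temp x₀ v₀ T
                (β + d.1 * ε) (β + d.2 * ε) P X V X' V' →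
              c ≤ Var[X T - X' T; P] ∧ Var[X T - X' T; P] ≤ C ∧
              c ≤ Var[V T - V' T; P] ∧ Var[V T - V' T; P] ≤ C ∧
              |cov[X T - X' T, V T - V' T; P]| ≤ C))) := by
  refine ⟨Langevin.charpoly_driftMatrix_roots ω, ?_, ?_⟩
  · intro β β' hβ hne hβ' hne' Ω _ P _ X V X' V'
    constructor
    · intro h
      obtain ⟨hm, hc, hX, hX', -⟩ := h.moments hω hT hβ hne hβ' hne'
      refine ⟨hm, ?_, ?_, ?_⟩
      · rw [hc, Langevin.ofReal_integral_posKernel_mul hω hkB hTemp hβ hβ']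
      · rw [hX, Langevin.ofReal_integral_posKernel_sq hω hkB hTemp hβ]
      · rw [hX', Langevin.ofReal_integral_posKernel_sq hω hkB hTemp hβ']
    · intro h
      obtain ⟨hm, hc, hX, hX', -⟩ := h.moments hω hT hβ hne hβ' hne'
      refine ⟨hm, hc, ?_, ?_⟩
      · rw [hX, Langevin.ofReal_integral_posKernel_sq hω hkB hTemp hβ]
      · rw [hX', Langevin.ofReal_integral_posKernel_sq hω hkB hTemp hβ']
  · intro β hβ hne
    have hψ := Langevin.contDiffAt_psiPert (n := 3) (γ := 2 * kB * Temp) (T := T) hω hβ hne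
    have hφ := Langevin.contDiffAt_phiPert (n := 3) (γ := 2 * kB * Temp) (T := T) hω hβ hne
    refine ⟨hψ, hφ, Langevin.taylor_two_isBigO hψ, Langevin.taylor_two_neg_isBigO hψ,
      Langevin.taylor_two_isBigO hφ, Langevin.psiPert_zero _ _ _ _, Langevin.deriv_phiPert _ _ _ _,
      ?_, ?_, ?_⟩
    · obtain ⟨c, hc, hcz, C, δ, hδ, h⟩ :=
        Langevin.exists_central_common_expansion hω hkB hTemp hβ hne hT
      refine ⟨c, hc, hcz, C, δ, hδ, fun ε hε Ω _ P _ X V X' V' hcoup => ?_⟩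
      obtain ⟨⟨p, n⟩, ⟨p', n'⟩, hb⟩ := h ε hε
      rw [(hcoup.moments hω hT p n p' n').2.2.2.2.1]
      exact hb
    · obtain ⟨v, hv, hvz, C, δ, hδ, h⟩ :=
        Langevin.exists_central_independent_expansion hω hkB hTemp hβ hne hT
      refine ⟨v, hv, hvz, C, δ, hδ, fun ε hε Ω _ P _ X V X' V' hcoup => ?_⟩
      obtain ⟨⟨p, n⟩, ⟨p', n'⟩, hb⟩ := h ε hε
      rw [(hcoup.moments hω hT p n p' n').2.2.2.2.1]
      exact hb
    · intro d hd
      obtain ⟨hd₁, hd₂⟩ := Langevin.abs_le_of_mem_standardDifferences hd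
      obtain ⟨c, C, δ, hc, hδ, h⟩ :=
        Langevin.exists_difference_bounds hω hkB hTemp hβ hne hT
      -- The sign of `C` follows from the sandwich `c ≤ ∫ ≤ C` at `ε = 0`.
      have hC : 0 ≤ C := by
        obtain ⟨-, -, -, -, -, he⟩ := h d.1 d.2 0 hd₁ hd₂ (by simpa) _ _ rfl rfl
        have h0 := he _ (mem_insert _ _)
        exact (hc.le.trans h0.1).trans h0.2.1
      -- For independent paths each second moment is the sum of two contributions, each bounded by
      -- `C`.
      refine ⟨c, 2 * C, δ, hc, hδ, fun ε hε Ω _ P _ X V X' V' => ?_⟩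
      obtain ⟨⟨p, n⟩, ⟨p', n'⟩, hpos, hvel, hcov, he⟩ := h d.1 d.2 ε hd₁ hd₂ hε _ _ rfl rfl
      have hCε : C * ε ^ 2 ≤ 2 * C * ε ^ 2 :=
        mul_le_mul_of_nonneg_right (by linarith) (sq_nonneg ε)
      constructor
      · intro hcoup
        obtain ⟨-, -, -, -, hX, hV, hXV⟩ := hcoup.moments hω hT p n p' n'
        rw [hX, hV, hXV]
        exact ⟨hpos.trans hCε, hvel.trans hCε, hcov.trans hCε⟩
      · intro hcoup
        obtain ⟨-, -, -, -, hX, hV, hXV⟩ := hcoup.moments hω hT p n p' n'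
        obtain ⟨a1, a2, a3, a4, a5⟩ := he _ (mem_insert _ _)
        obtain ⟨b1, b2, b3, b4, b5⟩ := he _ (mem_insert_of_mem _ (mem_singleton _))
        rw [hX, hV, hXV]
        refine ⟨by linarith, by linarith, by linarith, by linarith, ?_⟩
        exact (abs_add_le _ _).trans (by linarith)
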